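/- Let $n\ge 1$, let $\alpha=(\alpha_1,\dots,\alpha_n)$ and $\beta=(\beta_1,\dots,\beta_{n-1},\beta_n)$ with $\beta_n=1$ be in $(\mathbb{Q}\cap(0,1])^n$, and let $p$ be a prime. Write $\mathbb{Z}_{(p)}$ for the ring of rationals whose denominator in lowest form is prime to $p$, $\mathbb{Z}_{(p)}^*$ for its units, and $v_p$ for the $p$-adic valuation. Put $$\mathcal{Q}_{\alpha,\beta}(i)=\frac{(\alpha_1)_i\cdots(\alpha_n)_i}{(\beta_1)_i\cdots(\beta_{n})_i},\qquad f(z)=\sum_{i\ge0}\mathcal{Q}_{\alpha,\beta}(i)z^i ,$$ where $(x)_0=1$, $(x)_i=x(x+1)\cdots(x+i-1)$ for $i\ge 1$ (so $(\beta_n)_i=i!$). For $\gamma\in\mathbb{Z}_{(p)}$ let $\mathfrak{D}_p(\gamma)$ be the unique element of $\mathbb{Z}_{(p)}$ with $p\mathfrak{D}_p(\gamma)-\gamma\in\{0,\dots,p-1\}$; let $\mathfrak{D}_p^k$ be its $k$-th iterate, applied componentwise to vectors. For $\alpha,\beta\in\mathbb{Z}_{(p)}^n$ let $S_{\alpha,\beta,p}$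 be the set of $r\in\{0,\dots,p-1\}$ such that $r\equiv 1-\beta_j \bmod p$ for some $j\in\{1,\dots,n\}$ and $v_p(\mathcal{Q}_{\alpha,\beta}(r))=0$. Let $d$ be the least common multiple of the denominators of the $\alpha_i$ and $\beta_j$ in lowest form. The height of a rational function is the maximum of the degrees of its numerator and denominator in lowest form. Assume that * $f\in\mathbb{Z}_{(p)}[[z]]$, and $\alpha_i,\beta_j\in\mathbb{Z}_{(p)}^*$ for all $i,j$ (so $p\nmid d$); let $l$ be the order of $p$ in $(\mathbb{Z}/d\mathbb{Z})^*$; * $(\alpha,\beta)$ has the property $\mathbf{P}_{p,l}$: for every $k\in\{1,\dots,l\}$ and all $i,j,s\in\{1,\dots,n\}$, 1. $\mathfrak{D}_p^k(\alpha_i)$ and $\mathfrak{D}_p^k(\beta_i)$ are in $\mathbb{Z}_{(p)}^*$; 2. $\mathfrak{D}_p^k(\alpha_i)-\mathfrak{D}_p^k(\beta_j)\in\mathbb{Z}_{(p)}^*$; 3. $\mathfrak{D}_p^k(\beta_j)-\mathfrak{D}_p^k(\beta_s)\in\mathbb{Z}_{(p)}^*$ if and only if $\beta_j\ne\beta_s$;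 4. if $\beta_j\neq1$ then $p\mathfrak{D}_p^k(\beta_j)-\mathfrak{D}_p^{k-1}(\beta_j)\ne p-1$; 5. $1-\mathfrak{D}_p^k(\beta_j)+\mathfrak{D}_p^k(\alpha_i)$ and $1-\mathfrak{D}_p^k(\beta_j)+\mathfrak{D}_p^k(\beta_i)$ are in $\mathbb{Z}_{(p)}^*$. Let $S=S_{\mathfrak{D}_p^{l-1}(\alpha),\mathfrak{D}_p^{l-1}(\beta),p}$. Then: 1. if $\#S=1$, there is $Q_1\in\mathbb{Z}_{(p)}[z]$ of degree less than $p^l$ with $f\equiv Q_1f^{p^l}\bmod p$; 2. if $\#S=2$, there are $Q_1,Q_2\in\mathbb{Z}_{(p)}(z)\cap\mathbb{Z}_{(p)}[[z]][z^{-1}]$, whose reductions mod $p$ are rational functions of height less than $2p^{2l}$, with $f\equiv Q_1f^{p^l}+Q_2f^{p^{2l}}\bmod p$; 3. if $\#S=t+1>2$, there are $Q_1,\dots,Q_{t+1}\in\mathbb{Z}_{(p)}(z)\cap\mathbb{Z}_{(p)}[[z]][z^{-1}]$, whose reductions mod $p$ are rational functions of height less than $5^t(t+1)!\,p^{2(t+1)l}$,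 with $$f\equiv \sum_{i=1}^{t+1}Q_i\,f^{p^{il}}\bmod p .$$ -/

import Mathlib

open scoped BigOperators LaurentSeries PowerSeries Polynomial

noncomputable section

namespace HypMod

/-- The local ring `ℤ_(p)`: the rational numbers whose denominator in lowest form is prime
to `p`. -/
def ZLoc (p : ℕ) [hp : Fact p.Prime] : Subring ℚ where
  carrier := {x | ¬ p ∣ x.den}
  zero_mem' := by simpa using hp.out.ne_one
  one_mem' := by simpa using hp.out.ne_one
  neg_mem' := by intro x hx; simpa using hx
  add_mem' := by
    intro x y hx hy h
    exact ((hp.out.dvd_mul).1 (h.trans (Rat.add_den_dvd x y))).elim hx hy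
  mul_mem' := by
    intro x y hx hy h
    exact ((hp.out.dvd_mul).1 (h.trans (Rat.mul_den_dvd x y))).elim hx hy

theorem mem_ZLoc {p : ℕ} [Fact p.Prime] {x : ℚ} : x ∈ ZLoc p ↔ ¬ p ∣ x.den := Iff.rfl

theorem den_ne_zero {p : ℕ} [Fact p.Prime] {x : ℚ} (hx : x ∈ ZLoc p) :
    (x.den : ZMod p) ≠ 0 := by
  rw [Ne, ZMod.natCast_eq_zero_iff]; exact hx

/-- The reduction `ℤ_(p) → 𝔽_p`, sending `a / b` to `(a mod p) / (b mod p)`. -/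
def red (p : ℕ) [Fact p.Prime] : ZLoc p →+* ZMod p where
  toFun x := ((x : ℚ).num : ZMod p) / ((x : ℚ).den : ZMod p)
  map_zero' := by simp
  map_one' := by simp
  map_add' x y := by
    have h := Rat.cast_add_of_ne_zero (α := ZMod p) (den_ne_zero x.2) (den_ne_zero y.2)
    simpa [Rat.cast_def] using h
  map_mul' x y := by
    have h := Rat.cast_mul_of_ne_zero (α := ZMod p) (den_ne_zero x.2) (den_ne_zero y.2)
    simpa [Rat.cast_def] using h

/-- `x` is a unit of `ℤ_(p)`. -/
def IsUnitLoc (p : ℕ) [Fact p.Prime] (x : ℚ) : Prop :=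
  ∃ h : x ∈ ZLoc p, IsUnit (⟨x, h⟩ : ZLoc p)

/-- `x ≡ y mod p`, that is, `x - y ∈ p ℤ_(p)`. -/
def CongrLoc (p : ℕ) [Fact p.Prime] (x y : ℚ) : Prop :=
  ∃ c ∈ ZLoc p, x - y = p * c

/-- Dwork's map `𝔇_p`: `𝔇_p(γ) = (γ + s) / p`, where `s ∈ {0, …, p - 1}` is the residue of `-γ`
modulo `p`. For `γ ∈ ℤ_(p)` it is characterized by `dwork_mem`, `dwork_spec` and
`dwork_unique`. (For `γ ∉ ℤ_(p)` the value has no meaning.) -/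
def dwork (p : ℕ) [Fact p.Prime] (γ : ℚ) : ℚ :=
  (γ + ((-((γ.num : ZMod p) / (γ.den : ZMod p))).val : ℚ)) / p

theorem natCast_mem_ZLoc (p : ℕ) [Fact p.Prime] (s : ℕ) : (s : ℚ) ∈ ZLoc p :=
  natCast_mem _ s

/-- An element of `ℤ_(p)` that reduces to `0` is `p` times an element of `ℤ_(p)`. -/
theorem exists_of_red_eq_zero {p : ℕ} [hp : Fact p.Prime] (x : ZLoc p) (h : red p x = 0) :
    ∃ c ∈ ZLoc p, (x : ℚ) = p * c := by
  have hp0 : (p : ℚ) ≠ 0 := by exact_mod_cast hp.out.ne_zero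
  have hnum : ((x : ℚ).num : ZMod p) = 0 := by
    have h' : ((x : ℚ).num : ZMod p) / ((x : ℚ).den : ZMod p) = 0 := h
    exact (div_eq_zero_iff.1 h').resolve_right (den_ne_zero x.2)
  obtain ⟨c, hc⟩ := (ZMod.intCast_zmod_eq_zero_iff_dvd _ p).1 hnum
  have hx : (x : ℚ) = p * ((c : ℚ) / ((x : ℚ).den : ℚ)) := by
    conv_lhs => rw [← Rat.num_div_den (x : ℚ), hc]
    push_cast; ring
  refine ⟨_, fun hdvd => x.2 (hdvd.trans ?_), hx⟩
  have := Rat.den_dvd c ((x : ℚ).den : ℤ)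
  exact_mod_cast this

theorem dwork_spec (p : ℕ) [hp : Fact p.Prime] (γ : ℚ) :
    ∃ s : ℕ, s < p ∧ p * dwork p γ - γ = s := by
  have hp0 : (p : ℚ) ≠ 0 := by exact_mod_cast hp.out.ne_zero
  refine ⟨_, ZMod.val_lt (-((γ.num : ZMod p) / (γ.den : ZMod p))), ?_⟩
  unfold dwork
  field_simp
  ring

theorem dwork_mem (p : ℕ) [hp : Fact p.Prime] {γ : ℚ} (hγ : γ ∈ ZLoc p) :
    dwork p γ ∈ ZLoc p := by
  have hp0 : (p : ℚ) ≠ 0 := by exact_mod_cast hp.out.ne_zero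
  set s : ℕ := (-(red p ⟨γ, hγ⟩)).val with hs
  obtain ⟨c, hc, h⟩ := exists_of_red_eq_zero ((⟨γ, hγ⟩ : ZLoc p) + (s : ZLoc p)) (by
    rw [map_add, map_natCast, hs, ZMod.natCast_zmod_val]; ring)
  have hd : dwork p γ = c := by
    have e : dwork p γ = (γ + (s : ℚ)) / p := rfl
    rw [e, div_eq_iff hp0, mul_comm c]
    simpa using h
  rwa [hd]

theorem dwork_unique (p : ℕ) [hp : Fact p.Prime] {γ δ : ℚ} (hγ : γ ∈ ZLoc p)
    (hδ : δ ∈ ZLoc p) (h : ∃ s : ℕ, s < p ∧ p * δ - γ = s) : δ = dwork p γ := by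
  have hp0 : (p : ℚ) ≠ 0 := by exact_mod_cast hp.out.ne_zero
  obtain ⟨s, hs, e⟩ := h
  have e' : (p : ZLoc p) * ⟨δ, hδ⟩ - ⟨γ, hγ⟩ = (s : ZLoc p) := by
    apply Subtype.ext; simpa using e
  have e2 := congrArg (red p) e'
  simp only [map_sub, map_mul, map_natCast, CharP.cast_eq_zero, zero_mul, zero_sub] at e2
  have e3 : (-(red p ⟨γ, hγ⟩)).val = s := by
    rw [e2, ZMod.val_natCast, Nat.mod_eq_of_lt hs]
  have e4 : dwork p γ = (γ + ((-(red p ⟨γ, hγ⟩)).val : ℚ)) / p := rfl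
  rw [e4, e3, eq_div_iff hp0, mul_comm δ]
  linarith

/-- The action of `𝔇_p` on vectors, component by component. -/
def dworkVec {n : ℕ} (p : ℕ) [Fact p.Prime] (γ : Fin n → ℚ) : Fin n → ℚ := fun i => dwork p (γ i)

/-- The Pochhammer symbol `(x)_i = x (x + 1) ⋯ (x + i - 1)`. -/
def poch (x : ℚ) (i : ℕ) : ℚ := (ascPochhammer ℚ i).eval x

/-- The coefficient `𝒬_{α,β}(i) = (α_1)_i ⋯ (α_n)_i / ((β_1)_i ⋯ (β_n)_i)`. As `β_n = 1`, the
last factor of the denominator is `i!`. -/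
def hypCoeff {n : ℕ} (α β : Fin n → ℚ) (i : ℕ) : ℚ :=
  (∏ j, poch (α j) i) / ∏ j, poch (β j) i

/-- The hypergeometric series `_nF_{n-1}(α, β; z)`. -/
def hypSeries {n : ℕ} (α β : Fin n → ℚ) : ℚ⟦X⟧ := PowerSeries.mk (hypCoeff α β)

/-- `d_{α,β}`: the least common multiple of the denominators of the parameters. -/
def denLcm {n : ℕ} (α β : Fin n → ℚ) : ℕ :=
  Nat.lcm (Finset.univ.lcm fun i => (α i).den) (Finset.univ.lcm fun i => (β i).den)

open Classical in
/-- `E_{α,β,p}`: the `r ∈ {0, …, p - 1}` whose class modulo `p` is one of the exponents at zero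
`1 - β_1, …, 1 - β_{n-1}, 1 - β_n = 0` of the hypergeometric operator reduced modulo `p`. -/
def expSet {n : ℕ} (β : Fin n → ℚ) (p : ℕ) [Fact p.Prime] : Finset ℕ :=
  (Finset.range p).filter fun r => ∃ j, CongrLoc p (r : ℚ) (1 - β j)

/-- `S_{α,β,p}`: the `r ∈ E_{α,β,p}` such that `𝒬_{α,β}(r)` has `p`-adic valuation `0`. -/
def sSet {n : ℕ} (α β : Fin n → ℚ) (p : ℕ) [Fact p.Prime] : Finset ℕ :=
  (expSet β p).filter fun r => padicValRat p (hypCoeff α β r) = 0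

/-- The property `P_{p,l}` of the couple `(α, β)`. -/
structure PProp {n : ℕ} (α β : Fin n → ℚ) (p l : ℕ) [Fact p.Prime] : Prop where
  mem_left : ∀ i, α i ∈ ZLoc p
  mem_right : ∀ i, β i ∈ ZLoc p
  P1 : ∀ k, 1 ≤ k → k ≤ l → ∀ i,
    IsUnitLoc p ((dwork p)^[k] (α i)) ∧ IsUnitLoc p ((dwork p)^[k] (β i))
  P2 : ∀ k, 1 ≤ k → k ≤ l → ∀ i j,
    IsUnitLoc p ((dwork p)^[k] (α i) - (dwork p)^[k] (β j))
  P3 : ∀ k, 1 ≤ k → k ≤ l → ∀ j s,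
    IsUnitLoc p ((dwork p)^[k] (β j) - (dwork p)^[k] (β s)) ↔ β j ≠ β s
  P4 : ∀ k, 1 ≤ k → k ≤ l → ∀ j, β j ≠ 1 →
    (p : ℚ) - 1 ≠ p * (dwork p)^[k] (β j) - (dwork p)^[k - 1] (β j)
  P5 : ∀ k, 1 ≤ k → k ≤ l → ∀ i j,
    IsUnitLoc p (1 - (dwork p)^[k] (β j) + (dwork p)^[k] (α i)) ∧
      IsUnitLoc p (1 - (dwork p)^[k] (β j) + (dwork p)^[k] (β i))

/-- The height of a rational function: the larger of the degrees of the numerator and of the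
denominator in lowest form. -/
def height {K : Type*} [Field K] (q : RatFunc K) : ℕ := max q.num.natDegree q.denom.natDegree

/-- The rational function `Q` belongs to `ℤ_(p)(z) ∩ ℤ_(p)[[z]][z⁻¹]`: its Laurent expansion at
zero has coefficients in `ℤ_(p)`. (The fraction field of `ℤ_(p)[z]` is `ℚ(z)`.) -/
def IsIntegralAt (p : ℕ) [Fact p.Prime] (Q : RatFunc ℚ) : Prop :=
  ∀ m : ℤ, (Q : ℚ⸨X⸩).coeff m ∈ ZLoc p

/-- The rational function `q` over `𝔽_p` is the reduction modulo `p` of `Q`: the Laurent expansion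
of `q` is the reduction, coefficient by coefficient, of that of `Q`. -/
def ReducesTo (p : ℕ) [Fact p.Prime] (Q : RatFunc ℚ) (q : RatFunc (ZMod p)) : Prop :=
  ∃ h : IsIntegralAt p Q, ∀ m : ℤ,
    (q : (ZMod p)⸨X⸩).coeff m = red p ⟨(Q : ℚ⸨X⸩).coeff m, h m⟩

/-- Congruence modulo `p` of Laurent series, coefficient by coefficient. -/
def LaurentCongr (p : ℕ) [Fact p.Prime] (A B : ℚ⸨X⸩) : Prop :=
  ∀ m : ℤ, CongrLoc p (A.coeff m) (B.coeff m)

end HypMod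

end

/-!
Write `q = p ^ l`. Splitting off the last base-`p` digit of the index, `(γ)_{pm + r}` is, up to a
unit that is constant modulo `p` as `m` varies, `p ^ m` times `(δ)_m` with `δ = 𝔇_p(γ)`, or
`p ^ (m + 1)` times `(δ + 1)_m` if one of `γ, …, γ + r - 1` is divisible by `p`
(`poch_mul_add_eq`). Hence `𝒬_{α,β}(pm + r)` is a power of `p` times a coefficient of index `m` of a
hypergeometric series whose parameters are those of `𝔇_p(α), 𝔇_p(β)`, each shifted by `0` or `1`
(`hypCoeff_mul_add`). These shifted series are integral (`Good.integral_shift`), so modulo `p` only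
the `r` for which the power of `p` is trivial survive.

The property `P_{p,l}` keeps the residues of the parameters so far apart that shifting does not
change their relative order. So the shifts produced by a series that is already shifted are those
produced by the unshifted one, and they are in turn indexed by `S` (`Good.exists_mem_sSet`).
Therefore a shifted series is modulo `p` a combination of the `p`-th powers of the shifted series of
the next level that belong to elements of `S` (`Good.redSeries_eq_sum`). After `l` levels `𝔇_p^l` is
the identity (`iterate_dwork_eq_self`), and the reduction of `f` is a member of a finite family
`(y_r)_{r ∈ S}` with `y_r = ∑_s C_{rs} y_s ^ q`, the `C_{rs}` being polynomials of degree less than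
`q` (`exists_frobenius_system`).

If `S` has one element, this is the claim. In general let `N = #S`. The `N + 1` series `f ^ q ^ i`,
`0 ≤ i ≤ N`, are combinations of the `N` series `y_s ^ q ^ N`, so a dimension count gives a relation
`∑ c_i f ^ q ^ i = 0` with polynomials `c_i`, not all zero, of degree at most `N (q ^ N - 1)`
(`exists_polynomial_relation`). Cartier operators lower the exponents until `c_0 ≠ 0`
(`exists_relation_ne_zero`). The quotients `-c_i / c_0` lift to rational functions over `ℚ` with
Laurent expansions over `ℤ_(p)` (`exists_lift_relation`), and `N (q ^ N - 1)` is below the bounds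
claimed for the heights.
-/

noncomputable section

namespace HypMod

/-! ### Reduction modulo `p` and base-`p` digits of parameters -/

section

variable {p : ℕ} [hp : Fact p.Prime]

theorem red_mk {x : ℚ} (h : x ∈ ZLoc p) : red p ⟨x, h⟩ = (x : ZMod p) :=
  (Rat.cast_def x).symm

theorem red_apply (x : ZLoc p) : red p x = ((x : ℚ) : ZMod p) := red_mk x.2

theorem cast_add {x y : ℚ} (hx : x ∈ ZLoc p) (hy : y ∈ ZLoc p) :
    ((x + y : ℚ) : ZMod p) = x + y :=
  Rat.cast_add_of_ne_zero (den_ne_zero hx) (den_ne_zero hy)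

theorem cast_sub {x y : ℚ} (hx : x ∈ ZLoc p) (hy : y ∈ ZLoc p) :
    ((x - y : ℚ) : ZMod p) = x - y :=
  Rat.cast_sub_of_ne_zero (den_ne_zero hx) (den_ne_zero hy)

theorem cast_mul {x y : ℚ} (hx : x ∈ ZLoc p) (hy : y ∈ ZLoc p) :
    ((x * y : ℚ) : ZMod p) = x * y :=
  Rat.cast_mul_of_ne_zero (den_ne_zero hx) (den_ne_zero hy)

/-- An element of `ℤ_(p)` with non-zero reduction is invertible, as `ℤ_(p)` is local with residue
field `𝔽_p`. -/
theorem isUnit_of_red_ne_zero {x : ZLoc p} (h : red p x ≠ 0) : IsUnit x := by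
  have hx0 : (x : ℚ) ≠ 0 := by
    rintro h0
    exact h (by rw [red_apply, h0, Rat.cast_zero])
  have hinv : (x : ℚ)⁻¹ ∈ ZLoc p := by
    rw [mem_ZLoc, Rat.den_inv_of_ne_zero hx0]
    intro hd
    apply h
    rw [red_apply, Rat.cast_def, (ZMod.intCast_zmod_eq_zero_iff_dvd _ p).2
      (Int.natCast_dvd.2 hd), zero_div]
  exact IsUnit.of_mul_eq_one ⟨_, hinv⟩ (Subtype.ext (mul_inv_cancel₀ hx0))

theorem isUnitLoc_iff {x : ℚ} : IsUnitLoc p x ↔ x ∈ ZLoc p ∧ (x : ZMod p) ≠ 0 := by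
  constructor
  · rintro ⟨h, hu⟩
    exact ⟨h, by rw [← red_mk h]; exact (hu.map (red p)).ne_zero⟩
  · rintro ⟨h, h0⟩
    exact ⟨h, isUnit_of_red_ne_zero (by rwa [red_mk h])⟩

theorem IsUnitLoc.inv_mem {x : ℚ} (h : IsUnitLoc p x) : x⁻¹ ∈ ZLoc p := by
  obtain ⟨hx, hu⟩ := h
  obtain ⟨y, hy⟩ := hu.exists_right_inv
  have : x * (y : ℚ) = 1 := congrArg Subtype.val hy
  rw [inv_eq_of_mul_eq_one_right this]
  exact y.2

/-- The digit of `γ ∈ ℤ_(p)`: the residue of `-γ` modulo `p`, so that `p 𝔇_p(γ) = γ + digit γ`. -/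
def digit (p : ℕ) [Fact p.Prime] (γ : ℚ) : ℕ := (-(γ : ZMod p)).val

theorem digit_lt (γ : ℚ) : digit p γ < p := ZMod.val_lt _

theorem cast_digit (γ : ℚ) : ((digit p γ : ℕ) : ZMod p) = -(γ : ZMod p) :=
  ZMod.natCast_zmod_val _

theorem mul_dwork (γ : ℚ) : (p : ℚ) * dwork p γ = γ + digit p γ := by
  have hp0 : (p : ℚ) ≠ 0 := by exact_mod_cast hp.out.ne_zero
  have : dwork p γ = (γ + digit p γ) / p := by rw [digit, Rat.cast_def]; rfl
  rw [this, mul_div_cancel₀ _ hp0]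

theorem eq_digit {γ : ℚ} {r : ℕ} (hr : r < p) (h : (γ : ZMod p) + r = 0) : r = digit p γ := by
  rw [digit, ← eq_neg_of_add_eq_zero_right h, ZMod.val_natCast, Nat.mod_eq_of_lt hr]

/-- `digit` and `dwork` after a translation that stays inside the residue interval. -/
theorem digit_dwork_add {γ : ℚ} (hγ : γ ∈ ZLoc p) {u : ℕ} (hu : u ≤ digit p γ) :
    digit p (γ + u) = digit p γ - u ∧ dwork p (γ + u) = dwork p γ := by
  have hp0 : (p : ℚ) ≠ 0 := by exact_mod_cast hp.out.ne_zero
  have h1 : digit p (γ + u) = digit p γ - u := by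
    refine (eq_digit (lt_of_le_of_lt (Nat.sub_le _ _) (digit_lt γ)) ?_).symm
    rw [cast_add hγ (natCast_mem_ZLoc p u), Rat.cast_natCast, Nat.cast_sub hu, cast_digit]
    ring
  refine ⟨h1, mul_left_cancel₀ hp0 ?_⟩
  rw [mul_dwork, mul_dwork, h1, Nat.cast_sub hu]
  ring

/-- Translation by a multiple of `p` keeps the digit and translates `𝔇_p`. -/
theorem digit_dwork_add_mul {γ : ℚ} (hγ : γ ∈ ZLoc p) (m : ℕ) :
    digit p (γ + p * m) = digit p γ ∧ dwork p (γ + p * m) = dwork p γ + m := by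
  have hp0 : (p : ℚ) ≠ 0 := by exact_mod_cast hp.out.ne_zero
  have h0 : ((γ + p * m : ℚ) : ZMod p) = γ := by
    have := cast_add hγ (natCast_mem_ZLoc p (p * m))
    push_cast at this
    rw [this, Rat.cast_mul_of_ne_zero (by simp) (by simp)]
    simp
  have h1 : digit p (γ + p * m) = digit p γ := by rw [digit, h0, digit]
  refine ⟨h1, mul_left_cancel₀ hp0 ?_⟩
  rw [mul_dwork, mul_add, mul_dwork, h1]
  ring

theorem digit_pos {γ : ℚ} (h : IsUnitLoc p γ) : 1 ≤ digit p γ := by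
  rw [Nat.one_le_iff_ne_zero]
  intro h0
  have := cast_digit (p := p) γ
  rw [h0, Nat.cast_zero, zero_eq_neg] at this
  exact (isUnitLoc_iff.1 h).2 this

/-! ### Pochhammer symbols along arithmetic progressions -/

theorem poch_zero (x : ℚ) : poch x 0 = 1 := by simp [poch]

theorem poch_succ (x : ℚ) (i : ℕ) : poch x (i + 1) = poch x i * (x + i) := by
  simp [poch, ascPochhammer_succ_eval]

theorem poch_add (x : ℚ) (i j : ℕ) :
    poch x (i + j) = poch x i * ∏ k ∈ Finset.range j, (x + i + k) := by
  induction j with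
  | zero => simp
  | succ j ih => rw [← add_assoc, poch_succ, ih, Finset.prod_range_succ]; push_cast; ring

theorem poch_mul_add (x : ℚ) (i : ℕ) : poch x i * (x + i) = x * poch (x + 1) i := by
  induction i with
  | zero => simp [poch_zero]
  | succ i ih =>
    rw [poch_succ, ih, poch_succ]; push_cast; ring

/-- The non-zero part of a residue: `x` itself if `x ≠ 0`, and `1` otherwise. -/
def unitPart (x : ZMod p) : ZMod p := if x = 0 then 1 else x

theorem unitPart_ne_zero (x : ZMod p) : unitPart x ≠ 0 := by
  unfold unitPart; split_ifs with h
  · exact one_ne_zero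
  · exact h

/-- Among `r ≤ p` consecutive translates of `γ` at most one is divisible by `p`. It is the translate
by `digit γ`, which equals `p 𝔇_p(γ)`. -/
theorem prod_translates {γ : ℚ} (hγ : γ ∈ ZLoc p) {r : ℕ} (hr : r ≤ p) :
    ∃ U : ZLoc p, ∏ k ∈ Finset.range r, (γ + k) =
        (if digit p γ < r then p * dwork p γ else 1) * U ∧
      red p U = ∏ k ∈ Finset.range r, unitPart ((γ : ZMod p) + (k : ZMod p)) := by
  induction r with
  | zero => exact ⟨1, by simp, by simp⟩
  | succ r ih =>
    obtain ⟨U, hU, hred⟩ := ih (by omega)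
    by_cases h0 : (γ : ZMod p) + r = 0
    · have hd := eq_digit (by omega) h0
      refine ⟨U, ?_, ?_⟩
      · rw [Finset.prod_range_succ, hU, if_neg (by omega), if_pos (by omega), mul_dwork, ← hd]
        ring
      · rw [Finset.prod_range_succ, h0, hred]; simp [unitPart]
    · have hd : digit p γ ≠ r := by
        intro h
        apply h0
        rw [← h, cast_digit, add_neg_cancel]
      refine ⟨U * (⟨γ, hγ⟩ + (r : ZLoc p)), ?_, ?_⟩
      · have : (digit p γ < r + 1) ↔ digit p γ < r := by omega
        simp only [this]
        rw [Finset.prod_range_succ, hU]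
        push_cast
        ring
      · rw [Finset.prod_range_succ, map_mul, hred, map_add, red_mk, map_natCast]
        congr 1
        simp [unitPart, h0]

/-- The product of the unit parts over a full residue system does not depend on `γ`. -/
theorem prod_unitPart_range (x : ZMod p) :
    ∏ k ∈ Finset.range p, unitPart (x + (k : ZMod p)) = ∏ y : ZMod p, unitPart y := by
  rw [← Equiv.prod_comp (Equiv.addLeft x)]
  refine Finset.prod_bij (fun k _ => (k : ZMod p)) (by simp) ?_ ?_ (by simp)
  · intro a ha b hb h
    have := congrArg ZMod.val h
    rwa [ZMod.val_natCast, ZMod.val_natCast, Nat.mod_eq_of_lt (Finset.mem_range.1 ha),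
      Nat.mod_eq_of_lt (Finset.mem_range.1 hb)] at this
  · intro y _
    exact ⟨y.val, Finset.mem_range.2 (ZMod.val_lt y), ZMod.natCast_zmod_val y⟩

theorem add_mul_mem {γ : ℚ} (hγ : γ ∈ ZLoc p) (m : ℕ) : γ + p * m ∈ ZLoc p := by
  have := add_mem hγ (natCast_mem_ZLoc p (p * m))
  push_cast at this
  exact this

theorem cast_add_mul {γ : ℚ} (hγ : γ ∈ ZLoc p) (m : ℕ) :
    ((γ + p * m : ℚ) : ZMod p) = γ := by
  have := cast_add hγ (natCast_mem_ZLoc p (p * m))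
  push_cast at this
  rw [this, Rat.cast_mul_of_ne_zero (by simp) (by simp)]
  simp

theorem poch_mul {γ : ℚ} (hγ : γ ∈ ZLoc p) (m : ℕ) :
    ∃ U : ZLoc p, poch γ (p * m) = p ^ m * poch (dwork p γ) m * U ∧
      red p U = (∏ y : ZMod p, unitPart y) ^ m := by
  induction m with
  | zero => exact ⟨1, by simp [poch_zero], by simp⟩
  | succ m ih =>
    obtain ⟨U, hU, hred⟩ := ih
    obtain ⟨V, hV, hredV⟩ := prod_translates (add_mul_mem hγ m) le_rfl
    refine ⟨U * V, ?_, ?_⟩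
    · rw [mul_add, mul_one, poch_add, hU]
      push_cast
      rw [hV, if_pos (digit_lt _), (digit_dwork_add_mul hγ m).2, poch_succ]
      ring
    · rw [map_mul, hred, hredV, prod_unitPart_range, pow_succ]

/-- The translation by `0` or `1` that `𝔇_p(γ)` undergoes when `(γ)_{r + pm}` is compared with
`(𝔇_p(γ))_m`: it is `1` if one of `γ, …, γ + r - 1` is divisible by `p`. -/
def shift (p : ℕ) [Fact p.Prime] (γ : ℚ) (r : ℕ) : ℕ := if digit p γ < r then 1 else 0

/-- The Pochhammer symbol along the progression `pm + r`. The factor `c` does not depend on `m`; the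
power of the product of all non-zero residues does not depend on `γ`, and so cancels in a quotient
of equally many Pochhammer symbols. -/
theorem poch_mul_add_eq {γ : ℚ} (hγ : γ ∈ ZLoc p) (hD : IsUnitLoc p (dwork p γ)) {r : ℕ}
    (hr : r ≤ p) :
    ∃ c : ZMod p, c ≠ 0 ∧ ∀ m : ℕ, ∃ U : ZLoc p,
      poch γ (p * m + r) = p ^ m * p ^ shift p γ r * poch (dwork p γ + shift p γ r) m * U ∧
        red p U = (∏ y : ZMod p, unitPart y) ^ m * c := by
  have hDm := (isUnitLoc_iff.1 hD).1
  refine ⟨(∏ k ∈ Finset.range r, unitPart ((γ : ZMod p) + (k : ZMod p))) *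
    ((dwork p γ : ℚ) : ZMod p) ^ shift p γ r, ?_, ?_⟩
  · exact mul_ne_zero (Finset.prod_ne_zero_iff.2 fun _ _ => unitPart_ne_zero _)
      (pow_ne_zero _ (isUnitLoc_iff.1 hD).2)
  · intro m
    obtain ⟨U, hU, hred⟩ := poch_mul hγ m
    obtain ⟨V, hV, hredV⟩ := prod_translates (add_mul_mem hγ m) hr
    refine ⟨U * V * ⟨_, hDm⟩ ^ shift p γ r, ?_, ?_⟩
    · rw [poch_add, hU]
      push_cast
      rw [hV, (digit_dwork_add_mul hγ m).2, (digit_dwork_add_mul hγ m).1, shift]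
      split_ifs with h
      · have := poch_mul_add (dwork p γ) m
        push_cast
        linear_combination (p : ℚ) ^ m * p * U * V * this
      · simp
        ring
    · rw [map_mul, map_mul, map_pow, hred, hredV, cast_add_mul hγ, red_mk]
      ring

/-- Comparison of `𝒬_{a,b}(pm + r)` with the coefficient of index `m` of the hypergeometric series
whose parameters are the images under `𝔇_p`, shifted according to `r`. The unit `V` is constant
modulo `p` as `m` varies. -/
theorem hypCoeff_mul_add {n : ℕ} {a b : Fin n → ℚ} (ha : ∀ i, a i ∈ ZLoc p)
    (hb : ∀ i, b i ∈ ZLoc p) (hDa : ∀ i, IsUnitLoc p (dwork p (a i)))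
    (hDb : ∀ i, IsUnitLoc p (dwork p (b i))) {r : ℕ} (hr : r ≤ p) :
    ∃ c : ZMod p, c ≠ 0 ∧ ∀ m : ℕ, ∃ V : ZLoc p, red p V = c ∧
      p ^ (∑ i, shift p (b i) r) * hypCoeff a b (p * m + r) =
        p ^ (∑ i, shift p (a i) r) *
          hypCoeff (fun i => dwork p (a i) + shift p (a i) r)
            (fun i => dwork p (b i) + shift p (b i) r) m * V := by
  have hp0 : (p : ℚ) ≠ 0 := by exact_mod_cast hp.out.ne_zero
  choose ca hca Ua hUa using fun i => poch_mul_add_eq (ha i) (hDa i) hr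
  choose cb hcb Ub hUb using fun i => poch_mul_add_eq (hb i) (hDb i) hr
  have hK : (∏ y : ZMod p, unitPart y) ≠ 0 :=
    Finset.prod_ne_zero_iff.2 fun _ _ => unitPart_ne_zero _
  refine ⟨(∏ i, ca i) / ∏ i, cb i, div_ne_zero (Finset.prod_ne_zero_iff.2 fun i _ => hca i)
    (Finset.prod_ne_zero_iff.2 fun i _ => hcb i), fun m => ?_⟩
  have hredb : red p (∏ i, Ub i m) = (∏ y : ZMod p, unitPart y) ^ (m * n) * ∏ i, cb i := by
    rw [map_prod, Finset.prod_congr rfl fun i _ => (hUb i m).2, Finset.prod_mul_distrib,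
      Finset.prod_const, Finset.card_univ, Fintype.card_fin, pow_mul]
  have hreda : red p (∏ i, Ua i m) = (∏ y : ZMod p, unitPart y) ^ (m * n) * ∏ i, ca i := by
    rw [map_prod, Finset.prod_congr rfl fun i _ => (hUa i m).2, Finset.prod_mul_distrib,
      Finset.prod_const, Finset.card_univ, Fintype.card_fin, pow_mul]
  have hcb' : ∏ i, cb i ≠ 0 := Finset.prod_ne_zero_iff.2 fun i _ => hcb i
  have hub : IsUnit (∏ i, Ub i m) := isUnit_of_red_ne_zero (by
    rw [hredb]; exact mul_ne_zero (pow_ne_zero _ hK) hcb')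
  obtain ⟨W, hW⟩ := hub.exists_right_inv
  have hWq : (∏ i, (Ub i m : ℚ)) * (W : ℚ) = 1 := by
    have := congrArg Subtype.val hW
    push_cast at this
    exact this
  have hUb0 : (∏ i, (Ub i m : ℚ)) ≠ 0 := left_ne_zero_of_mul_eq_one hWq
  refine ⟨(∏ i, Ua i m) * W, ?_, ?_⟩
  · have h1 := congrArg (red p) hW
    rw [map_mul, hredb, map_one] at h1
    rw [map_mul, hreda, eq_div_iff hcb']
    linear_combination (∏ i, ca i) * h1
  · unfold hypCoeff
    simp only [(hUa _ m).1, (hUb _ m).1, Finset.prod_mul_distrib, Finset.prod_pow_eq_pow_sum]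
    push_cast
    rw [show (W : ℚ) = (∏ i, (Ub i m : ℚ))⁻¹ from (inv_eq_of_mul_eq_one_right hWq).symm]
    set X := ∏ i, poch (dwork p (b i) + shift p (b i) r) m
    by_cases hX : X = 0
    · simp [hX]
    · field_simp

end

/-! ### One step of the decomposition modulo `p` -/

section

variable {p : ℕ} [hp : Fact p.Prime] {n : ℕ}

/-- The conditions on a couple of parameter vectors under which the decomposition modulo `p` of
`hypSeries a b` and of its shifts holds: those of the property `P_{p,l}` at one level, together with
the integrality of the series. The condition `digit_b` is the one that `P_{p,l}` states in terms of
two consecutive levels. -/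
structure Good (p : ℕ) [Fact p.Prime] (a b : Fin (n + 1) → ℚ) : Prop where
  a_pos : ∀ i, 0 < a i
  b_pos : ∀ i, 0 < b i
  a_unit : ∀ i, IsUnitLoc p (a i)
  b_unit : ∀ i, IsUnitLoc p (b i)
  sub_unit : ∀ i j, IsUnitLoc p (a i - b j)
  one_sub_add_left : ∀ i j, IsUnitLoc p (1 - b j + a i)
  one_sub_add_right : ∀ i j, IsUnitLoc p (1 - b j + b i)
  b_ne : ∀ i j, b i ≠ b j → IsUnitLoc p (b i - b j)
  last : b (Fin.last n) = 1
  digit_b : ∀ j, b j ≠ 1 → digit p (b j) ≠ p - 1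
  integral : ∀ m, hypCoeff a b m ∈ ZLoc p

/-- The shifts `(u, w)` of the parameters that occur in the decomposition: entries `0` or `1`, equal
lower parameters shifted equally, and the last lower parameter `1` not shifted. -/
structure Admissible (b : Fin (n + 1) → ℚ) (u w : Fin (n + 1) → ℕ) : Prop where
  u_le : ∀ i, u i ≤ 1
  w_le : ∀ i, w i ≤ 1
  w_eq : ∀ i j, b i = b j → w i = w j
  last : w (Fin.last n) = 0

theorem shift_le_one (γ : ℚ) (r : ℕ) : shift p γ r ≤ 1 := by
  unfold shift; split_ifs <;> omega

theorem digit_one : digit p 1 = p - 1 :=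
  (eq_digit (by have := hp.out.pos; omega) (by
    rw [Nat.cast_sub hp.out.one_lt.le]; simp)).symm

theorem ne_digit_of_sub_unit {x y : ℚ} (hx : x ∈ ZLoc p) (hy : y ∈ ZLoc p)
    (h : IsUnitLoc p (x - y)) : digit p x ≠ digit p y := by
  intro hd
  have := (isUnitLoc_iff.1 h).2
  rw [cast_sub hx hy] at this
  have h1 := cast_digit (p := p) x
  rw [hd, cast_digit] at h1
  exact this (by linear_combination h1)

theorem ne_digit_add_one {x y : ℚ} (hx : x ∈ ZLoc p) (hy : y ∈ ZLoc p)
    (h : IsUnitLoc p (1 - y + x)) : digit p x ≠ digit p y + 1 := by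
  intro hd
  have := (isUnitLoc_iff.1 h).2
  rw [cast_add (sub_mem (one_mem _) hy) hx, cast_sub (one_mem _) hy] at this
  have h1 := cast_digit (p := p) x
  rw [hd, Nat.cast_add, cast_digit] at h1
  apply this
  rw [Rat.cast_one]
  linear_combination h1

theorem poch_add_le_one {x : ℚ} (hx : x ≠ 0) {u : ℕ} (hu : u ≤ 1) (m : ℕ) :
    poch (x + u) m = poch x m * ((x + m) * x⁻¹) ^ u := by
  interval_cases u
  · simp
  · have := poch_mul_add x m
    rw [pow_one, ← mul_assoc, this]
    push_cast
    field_simp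

theorem poch_add_le_one' {x : ℚ} {m : ℕ} (hx : x ≠ 0) (hxm : x + m ≠ 0) {u : ℕ} (hu : u ≤ 1) :
    poch (x + u) m = poch x (m + 1) * ((x + m)⁻¹ ^ (1 - u) * x⁻¹ ^ u) := by
  rw [poch_add_le_one hx hu, poch_succ]
  interval_cases u
  · simp; field_simp
  · simp; field_simp

/-- Shifting by `0` or `1` the parameters of an integral hypergeometric series leaves it integral:
if a lower factor `b j + m` is divisible by `p`, then no upper factor `a i + m` is, and the
coefficient of index `m` is compared with `𝒬_{a,b}(m + 1)` instead of `𝒬_{a,b}(m)`. -/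
theorem Good.integral_shift {a b : Fin (n + 1) → ℚ} (h : Good p a b) {u w : Fin (n + 1) → ℕ}
    (hu : ∀ i, u i ≤ 1) (hw : ∀ i, w i ≤ 1) (m : ℕ) :
    hypCoeff (fun i => a i + u i) (fun i => b i + w i) m ∈ ZLoc p := by
  have ha0 : ∀ i, a i ≠ 0 := fun i => (h.a_pos i).ne'
  have hb0 : ∀ i, b i ≠ 0 := fun i => (h.b_pos i).ne'
  have hbm0 : ∀ i, b i + m ≠ 0 := fun i => by have := h.b_pos i; positivity
  have ham0 : ∀ i, a i + m ≠ 0 := fun i => by have := h.a_pos i; positivity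
  have ha : ∀ i, a i ∈ ZLoc p := fun i => (h.a_unit i).1
  have hb : ∀ i, b i ∈ ZLoc p := fun i => (h.b_unit i).1
  have ham : ∀ i, a i + m ∈ ZLoc p := fun i => add_mem (ha i) (natCast_mem_ZLoc p m)
  have hbm : ∀ i, b i + m ∈ ZLoc p := fun i => add_mem (hb i) (natCast_mem_ZLoc p m)
  by_cases hbu : ∀ j, IsUnitLoc p (b j + m)
  · have : hypCoeff (fun i => a i + u i) (fun i => b i + w i) m =
        hypCoeff a b m * (∏ i, ((a i + m) * (a i)⁻¹) ^ u i) *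
          ∏ i, (b i * (b i + m)⁻¹) ^ w i := by
      unfold hypCoeff
      simp only [fun i => poch_add_le_one (ha0 i) (hu i) m,
        fun i => poch_add_le_one (hb0 i) (hw i) m, Finset.prod_mul_distrib]
      rw [mul_div_mul_comm, div_eq_mul_inv (∏ i, _ ^ _), ← Finset.prod_inv_distrib]
      simp only [← inv_pow, mul_inv, inv_inv, mul_comm (b _)]
      rw [mul_assoc]
    rw [this]
    exact mul_mem (mul_mem (h.integral m)
      (prod_mem fun i _ => pow_mem (mul_mem (ham i) (h.a_unit i).inv_mem) _))
      (prod_mem fun i _ => pow_mem (mul_mem (hb i) (hbu i).inv_mem) _)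
  · push Not at hbu
    obtain ⟨j, hj⟩ := hbu
    have hj0 : ((b j + m : ℚ) : ZMod p) = 0 := by
      by_contra h0
      exact hj (isUnitLoc_iff.2 ⟨hbm j, h0⟩)
    have hau : ∀ i, IsUnitLoc p (a i + m) := by
      intro i
      refine isUnitLoc_iff.2 ⟨ham i, ?_⟩
      have h1 := (isUnitLoc_iff.1 (h.sub_unit i j)).2
      rw [show a i - b j = (a i + m) - (b j + m) by ring, cast_sub (ham i) (hbm j), hj0,
        sub_zero] at h1
      exact h1
    have : hypCoeff (fun i => a i + u i) (fun i => b i + w i) m =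
        hypCoeff a b (m + 1) * (∏ i, (a i + m)⁻¹ ^ (1 - u i) * (a i)⁻¹ ^ u i) *
          ∏ i, (b i + m) ^ (1 - w i) * (b i) ^ w i := by
      unfold hypCoeff
      simp only [fun i => poch_add_le_one' (ha0 i) (ham0 i) (hu i),
        fun i => poch_add_le_one' (hb0 i) (hbm0 i) (hw i)]
      simp only [Finset.prod_mul_distrib, inv_pow, Finset.prod_inv_distrib, div_eq_mul_inv,
        mul_inv, inv_inv]
      ring
    rw [this]
    exact mul_mem (mul_mem (h.integral _)
      (prod_mem fun i _ => mul_mem (pow_mem (hau i).inv_mem _) (pow_mem (h.a_unit i).inv_mem _)))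
      (prod_mem fun i _ => mul_mem (pow_mem (hbm i) _) (pow_mem (hb i) _))

theorem hypCoeff_zero {n : ℕ} (a b : Fin n → ℚ) : hypCoeff a b 0 = 1 := by
  simp [hypCoeff, poch_zero]

/-- For an integral hypergeometric series, the exponent of `p` in the numerator of `𝒬_{a,b}(r)` is
at least that in the denominator. -/
theorem sum_shift_le {n : ℕ} {a b : Fin n → ℚ} (ha : ∀ i, a i ∈ ZLoc p)
    (hb : ∀ i, b i ∈ ZLoc p) (hDa : ∀ i, IsUnitLoc p (dwork p (a i)))
    (hDb : ∀ i, IsUnitLoc p (dwork p (b i))) {r : ℕ} (hr : r ≤ p)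
    (hint : hypCoeff a b r ∈ ZLoc p) :
    ∑ i, shift p (b i) r ≤ ∑ i, shift p (a i) r := by
  have hp0 : (p : ℚ) ≠ 0 := by exact_mod_cast hp.out.ne_zero
  obtain ⟨c, hc, hV⟩ := hypCoeff_mul_add ha hb hDa hDb hr
  obtain ⟨V, hVc, hV⟩ := hV 0
  rw [mul_zero, zero_add, hypCoeff_zero, mul_one] at hV
  by_contra! hlt
  obtain ⟨k, hk⟩ := Nat.exists_eq_add_of_lt hlt
  apply hc
  have h1 : V = (p : ZLoc p) ^ (k + 1) * ⟨_, hint⟩ := by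
    apply Subtype.ext
    push_cast
    refine mul_left_cancel₀ (pow_ne_zero (∑ i, shift p (a i) r) hp0) ?_
    rw [← hV, hk]
    ring
  rw [← hVc, h1]
  simp

/-- If the exponents of `p` in numerator and denominator agree, then `𝒬_{a,b}(r)` has `p`-adic
valuation `0`. -/
theorem padicValRat_hypCoeff {n : ℕ} {a b : Fin n → ℚ} (ha : ∀ i, a i ∈ ZLoc p)
    (hb : ∀ i, b i ∈ ZLoc p) (hDa : ∀ i, IsUnitLoc p (dwork p (a i)))
    (hDb : ∀ i, IsUnitLoc p (dwork p (b i))) {r : ℕ} (hr : r ≤ p)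
    (hsum : ∑ i, shift p (b i) r = ∑ i, shift p (a i) r) :
    padicValRat p (hypCoeff a b r) = 0 := by
  have hp0 : (p : ℚ) ≠ 0 := by exact_mod_cast hp.out.ne_zero
  obtain ⟨c, hc, hV⟩ := hypCoeff_mul_add ha hb hDa hDb hr
  obtain ⟨V, hVc, hV⟩ := hV 0
  rw [mul_zero, zero_add, hypCoeff_zero, mul_one, hsum] at hV
  rw [mul_left_cancel₀ (pow_ne_zero _ hp0) hV]
  have hnum : ¬ (p : ℤ) ∣ (V : ℚ).num := by
    intro hd
    apply hc
    rw [← hVc, red_apply, Rat.cast_def, (ZMod.intCast_zmod_eq_zero_iff_dvd _ p).2 hd, zero_div]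
  rw [padicValRat, padicValInt.eq_zero_of_not_dvd hnum, padicValNat.eq_zero_of_not_dvd V.2]
  simp

theorem shift_add {γ : ℚ} (hγ : IsUnitLoc p γ) {u : ℕ} (hu : u ≤ 1) (t : ℕ) :
    shift p (γ + u) t = if digit p γ - u < t then 1 else 0 := by
  rw [shift, (digit_dwork_add hγ.1 (hu.trans (digit_pos hγ))).1]

theorem zero_mem_sSet {a b : Fin (n + 1) → ℚ} (hlast : b (Fin.last n) = 1) :
    0 ∈ sSet a b p := by
  classical
  unfold sSet expSet
  simp only [Finset.mem_filter, Finset.mem_range]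
  refine ⟨⟨hp.out.pos, Fin.last n, 0, zero_mem _, by simp [hlast]⟩, by simp [hypCoeff_zero]⟩

/-- For an index `t` at which numerator and denominator of the coefficient of the *shifted* series
contain the same power of `p`, the shift attached to `t` is already attached to an element of `S`
for the *unshifted* parameters: the exponent just below `t`. -/
theorem Good.exists_mem_sSet {a b : Fin (n + 1) → ℚ} (h : Good p a b)
    (hD : Good p (fun i => dwork p (a i)) (fun i => dwork p (b i)))
    {u w : Fin (n + 1) → ℕ} (hadm : Admissible b u w) {t : ℕ} (ht : t < p)
    (hsum : ∑ i, shift p (b i + w i) t = ∑ i, shift p (a i + u i) t) :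
    ∃ r ∈ sSet a b p, (∀ i, shift p (a i) r = shift p (a i + u i) t) ∧
      ∀ i, shift p (b i) r = shift p (b i + w i) t := by
  classical
  have ha : ∀ i, a i ∈ ZLoc p := fun i => (h.a_unit i).1
  have hb : ∀ i, b i ∈ ZLoc p := fun i => (h.b_unit i).1
  have hsa := fun i => shift_add (h.a_unit i) (hadm.u_le i)
  have hsb := fun i => shift_add (h.b_unit i) (hadm.w_le i)
  by_cases hex : ∃ j, digit p (b j) - w j < t
  · obtain ⟨j, hj, hmax⟩ := Finset.exists_max_image
      (Finset.univ.filter fun j => digit p (b j) - w j < t) (fun j => digit p (b j) - w j)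
      (by obtain ⟨j, hj⟩ := hex; exact ⟨j, by simpa using hj⟩)
    simp only [Finset.mem_filter, Finset.mem_univ, true_and] at hj hmax
    have hj1 : b j ≠ 1 := by
      intro h1
      rw [hadm.w_eq j (Fin.last n) (h1.trans h.last.symm), hadm.last, h1, digit_one] at hj
      omega
    have hrp : digit p (b j) + 1 < p := by
      have := h.digit_b j hj1
      have := digit_lt (p := p) (b j)
      omega
    -- distinct digits differ by at least `2`, so that shifts by at most `1` keep their order
    have hbsep : ∀ i, b i = b j ∨ digit p (b i) + 2 ≤ digit p (b j) ∨
        digit p (b j) + 2 ≤ digit p (b i) := by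
      intro i
      by_cases hij : b i = b j
      · exact Or.inl hij
      · right
        have h1 := ne_digit_of_sub_unit (hb i) (hb j) (h.b_ne i j hij)
        have h2 := ne_digit_add_one (hb i) (hb j) (h.one_sub_add_right i j)
        have h3 := ne_digit_add_one (hb j) (hb i) (h.one_sub_add_right j i)
        omega
    have hasep : ∀ i, digit p (a i) + 1 ≤ digit p (b j) ∨
        digit p (b j) + 2 ≤ digit p (a i) := by
      intro i
      have h1 := ne_digit_of_sub_unit (ha i) (hb j) (h.sub_unit i j)
      have h2 := ne_digit_add_one (ha i) (hb j) (h.one_sub_add_left i j)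
      omega
    have hwj := hadm.w_le j
    -- the exponent of the shifted series that lies just below `t`
    set t₀ := digit p (b j) - w j + 1 with ht₀
    have hB₀ : ∀ i, shift p (b i + w i) t₀ = shift p (b i + w i) t := by
      intro i
      rw [hsb, hsb]
      have := hmax i
      congr 1
      apply propext
      omega
    have hA₀ : ∀ i, shift p (a i + u i) t₀ ≤ shift p (a i + u i) t := by
      intro i
      rw [hsa, hsa]
      split_ifs <;> omega
    have hau : ∀ i, digit p (a i + u i) = digit p (a i) - u i ∧
        dwork p (a i + u i) = dwork p (a i) := fun i =>
      digit_dwork_add (ha i) ((hadm.u_le i).trans (digit_pos (h.a_unit i)))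
    have hbw : ∀ i, digit p (b i + w i) = digit p (b i) - w i ∧
        dwork p (b i + w i) = dwork p (b i) := fun i =>
      digit_dwork_add (hb i) ((hadm.w_le i).trans (digit_pos (h.b_unit i)))
    have hle := sum_shift_le (fun i => add_mem (ha i) (natCast_mem_ZLoc p (u i)))
      (fun i => add_mem (hb i) (natCast_mem_ZLoc p (w i)))
      (fun i => by rw [(hau i).2]; exact hD.a_unit i)
      (fun i => by rw [(hbw i).2]; exact hD.b_unit i) (r := t₀) (by omega)
      (h.integral_shift hadm.u_le hadm.w_le t₀)
    rw [Finset.sum_congr rfl fun i _ => hB₀ i, hsum] at hle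
    -- no upper digit lies between that exponent and `t`
    have hA₁ : ∀ i, shift p (a i + u i) t₀ = shift p (a i + u i) t := by
      intro i
      exact (Finset.sum_eq_sum_iff_of_le fun i _ => hA₀ i).1
        (le_antisymm (Finset.sum_le_sum fun i _ => hA₀ i) hle) i (Finset.mem_univ i)
    have hAr : ∀ i, shift p (a i) (digit p (b j) + 1) = shift p (a i + u i) t := by
      intro i
      rw [← hA₁, hsa, shift]
      have := hadm.u_le i
      have := hasep i
      congr 1
      apply propext
      omega
    have hBr : ∀ i, shift p (b i) (digit p (b j) + 1) = shift p (b i + w i) t := by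
      intro i
      rw [← hB₀, hsb, shift]
      have := hadm.w_le i
      congr 1
      apply propext
      rcases hbsep i with h1 | h1
      · rw [hadm.w_eq i j h1, h1]; omega
      · omega
    refine ⟨digit p (b j) + 1, ?_, hAr, hBr⟩
    unfold sSet expSet
    simp only [Finset.mem_filter, Finset.mem_range]
    refine ⟨⟨hrp, j, dwork p (b j), (hD.b_unit j).1, ?_⟩, ?_⟩
    · rw [mul_dwork]; push_cast; ring
    · refine padicValRat_hypCoeff ha hb (fun i => hD.a_unit i) (fun i => hD.b_unit i) hrp.le ?_
      simp only [hAr, hBr, hsum]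
  · push Not at hex
    have hB : ∀ i, shift p (b i + w i) t = 0 := by
      intro i
      rw [hsb, if_neg (by have := hex i; omega)]
    simp only [hB, Finset.sum_const_zero] at hsum
    have hA : ∀ i, shift p (a i + u i) t = 0 := fun i =>
      (Finset.sum_eq_zero_iff.1 hsum.symm) i (Finset.mem_univ i)
    exact ⟨0, zero_mem_sSet h.last, fun i => by rw [hA]; simp [shift],
      fun i => by rw [hB]; simp [shift]⟩

/-- Coefficients of a `q`-th power of a power series over `𝔽_p`, for `q` a power of `p`. -/
theorem coeff_pow (F : (ZMod p)⟦X⟧) (l k : ℕ) :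
    PowerSeries.coeff k (F ^ p ^ l) =
      if p ^ l ∣ k then PowerSeries.coeff (k / p ^ l) F else 0 := by
  have hq : p ^ l ≠ 0 := pow_ne_zero _ hp.out.ne_zero
  have hF : F ^ p ^ l = PowerSeries.expand (p ^ l) hq F := by
    have := MvPowerSeries.map_iterateFrobenius_expand (σ := Unit) p hp.out.ne_zero F l
    rw [← this]
    have h2 : iterateFrobenius (ZMod p) p l = RingHom.id _ := Subsingleton.elim _ _
    rw [h2]
    simp [PowerSeries.expand]
  rw [hF]
  split_ifs with h
  · obtain ⟨m, rfl⟩ := h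
    rw [PowerSeries.coeff_expand_mul, Nat.mul_div_cancel_left _ (Nat.pos_of_ne_zero hq)]
  · exact PowerSeries.coeff_expand_of_not_dvd _ _ _ h

theorem coeff_X_pow_mul_pow (F : (ZMod p)⟦X⟧) {l t s : ℕ} (ht : t < p ^ l) (hs : s < p ^ l)
    (m : ℕ) : PowerSeries.coeff (p ^ l * m + s) (PowerSeries.X ^ t * F ^ p ^ l) =
      if t = s then PowerSeries.coeff m F else 0 := by
  have hq : 0 < p ^ l := pow_pos hp.out.pos _
  rw [PowerSeries.coeff_X_pow_mul', coeff_pow]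
  split_ifs with h1 h2 h3 h3 h3
  · subst h3
    rw [Nat.add_sub_cancel, Nat.mul_div_cancel_left _ hq]
  · exfalso
    apply h3
    obtain ⟨k, hk⟩ := h2
    have : p ^ l * m + s = p ^ l * k + t := by omega
    have h4 := congrArg (· % p ^ l) this
    simp only [Nat.mul_add_mod, Nat.mod_eq_of_lt hs, Nat.mod_eq_of_lt ht] at h4
    exact h4.symm
  · subst h3; exact absurd (by simp) h2
  · rfl
  · omega
  · rfl

/-- The reduction modulo `p` of a hypergeometric series, by the cast `ℚ → 𝔽_p`. That cast is the
reduction map on `ℤ_(p)`, so the definition is meaningful for series with coefficients in `ℤ_(p)`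
only. -/
def redSeries (p : ℕ) [Fact p.Prime] {n : ℕ} (a b : Fin n → ℚ) : (ZMod p)⟦X⟧ :=
  PowerSeries.mk fun m => (hypCoeff a b m : ZMod p)

/-- One step of the decomposition: modulo `p`, a shift of the series with parameters `a`, `b` is a
combination, with polynomial coefficients of degree less than `p`, of the `p`-th powers of the
series attached to the elements of `S`, whose parameters are shifts of `𝔇_p(a)`, `𝔇_p(b)`. -/
theorem Good.redSeries_eq_sum {a b : Fin (n + 1) → ℚ} (h : Good p a b)
    (hD : Good p (fun i => dwork p (a i)) (fun i => dwork p (b i)))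
    {u w : Fin (n + 1) → ℕ} (hadm : Admissible b u w) :
    ∃ P : ℕ → (ZMod p)[X], (∀ r, (P r).natDegree ≤ p - 1) ∧
      redSeries p (fun i => a i + u i) (fun i => b i + w i) =
        ∑ r ∈ sSet a b p, (P r : (ZMod p)⟦X⟧) *
          redSeries p (fun i => dwork p (a i) + shift p (a i) r)
            (fun i => dwork p (b i) + shift p (b i) r) ^ p := by
  classical
  have hp0 : (p : ℚ) ≠ 0 := by exact_mod_cast hp.out.ne_zero
  have ha : ∀ i, a i ∈ ZLoc p := fun i => (h.a_unit i).1
  have hb : ∀ i, b i ∈ ZLoc p := fun i => (h.b_unit i).1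
  have ha' : ∀ i, a i + u i ∈ ZLoc p := fun i => add_mem (ha i) (natCast_mem_ZLoc p (u i))
  have hb' : ∀ i, b i + w i ∈ ZLoc p := fun i => add_mem (hb i) (natCast_mem_ZLoc p (w i))
  have hau : ∀ i, dwork p (a i + u i) = dwork p (a i) := fun i =>
    (digit_dwork_add (ha i) ((hadm.u_le i).trans (digit_pos (h.a_unit i)))).2
  have hbw : ∀ i, dwork p (b i + w i) = dwork p (b i) := fun i =>
    (digit_dwork_add (hb i) ((hadm.w_le i).trans (digit_pos (h.b_unit i)))).2
  have hDa : ∀ i, IsUnitLoc p (dwork p (a i + u i)) := fun i => by rw [hau]; exact hD.a_unit i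
  have hDb : ∀ i, IsUnitLoc p (dwork p (b i + w i)) := fun i => by rw [hbw]; exact hD.b_unit i
  have hc : ∀ t, ∃ c : ZMod p, t < p → ∀ m : ℕ, ∃ V : ZLoc p, red p V = c ∧
      p ^ (∑ i, shift p (b i + w i) t) *
          hypCoeff (fun i => a i + u i) (fun i => b i + w i) (p * m + t) =
        p ^ (∑ i, shift p (a i + u i) t) *
          hypCoeff (fun i => dwork p (a i) + shift p (a i + u i) t)
            (fun i => dwork p (b i) + shift p (b i + w i) t) m * V := by
    intro t
    by_cases ht : t < p
    · obtain ⟨c, -, hcV⟩ := hypCoeff_mul_add ha' hb' hDa hDb ht.le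
      simp only [hau, hbw] at hcV
      exact ⟨c, fun _ => hcV⟩
    · exact ⟨0, fun h => absurd h ht⟩
  choose c hc using hc
  set T := (Finset.range p).filter fun t =>
    ∑ i, shift p (b i + w i) t = ∑ i, shift p (a i + u i) t with hT
  have hρ : ∀ t, ∃ r, t ∈ T → r ∈ sSet a b p ∧
      (∀ i, shift p (a i) r = shift p (a i + u i) t) ∧
      ∀ i, shift p (b i) r = shift p (b i + w i) t := by
    intro t
    by_cases ht : t ∈ T
    · rw [hT, Finset.mem_filter, Finset.mem_range] at ht
      obtain ⟨r, h1, h2⟩ := h.exists_mem_sSet hD hadm ht.1 ht.2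
      exact ⟨r, fun _ => ⟨h1, h2⟩⟩
    · exact ⟨0, fun h => absurd h ht⟩
  choose ρ hρ using hρ
  refine ⟨fun r => ∑ t ∈ T with ρ t = r, Polynomial.monomial t (c t), fun r => ?_, ?_⟩
  · refine Polynomial.natDegree_sum_le_of_forall_le _ _ fun t ht =>
      (Polynomial.natDegree_monomial_le _).trans ?_
    simp only [hT, Finset.mem_filter, Finset.mem_range] at ht
    omega
  · have hrw : ∀ r ∈ sSet a b p,
        ((∑ t ∈ T with ρ t = r, Polynomial.monomial t (c t) : (ZMod p)[X]) : (ZMod p)⟦X⟧) *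
          redSeries p (fun i => dwork p (a i) + shift p (a i) r)
            (fun i => dwork p (b i) + shift p (b i) r) ^ p =
        ∑ t ∈ T with ρ t = r, PowerSeries.C (c t) * (PowerSeries.X ^ t *
          redSeries p (fun i => dwork p (a i) + shift p (a i + u i) t)
            (fun i => dwork p (b i) + shift p (b i + w i) t) ^ p ^ 1) := by
      intro r _
      rw [← Polynomial.coeToPowerSeries.ringHom_apply, map_sum, Finset.sum_mul]
      refine Finset.sum_congr rfl fun t ht => ?_
      obtain ⟨htT, rfl⟩ := Finset.mem_filter.1 ht
      simp only [(hρ t htT).2.1, (hρ t htT).2.2]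
      rw [Polynomial.coeToPowerSeries.ringHom_apply, ← Polynomial.C_mul_X_pow_eq_monomial,
        Polynomial.coe_mul, Polynomial.coe_pow, Polynomial.coe_C, Polynomial.coe_X, pow_one,
        mul_assoc]
    rw [Finset.sum_congr rfl hrw, Finset.sum_fiberwise_of_maps_to fun t ht => (hρ t ht).1]
    ext k
    obtain ⟨m, t, ht, rfl⟩ : ∃ m t, t < p ∧ k = p ^ 1 * m + t :=
      ⟨k / p, k % p, Nat.mod_lt _ hp.out.pos, by rw [pow_one, Nat.div_add_mod]⟩
    rw [map_sum]
    have hcoeff : ∀ s ∈ T, PowerSeries.coeff (p ^ 1 * m + t) (PowerSeries.C (c s) *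
        (PowerSeries.X ^ s *
          redSeries p (fun i => dwork p (a i) + shift p (a i + u i) s)
            (fun i => dwork p (b i) + shift p (b i + w i) s) ^ p ^ 1)) =
        if s = t then c t * (hypCoeff (fun i => dwork p (a i) + shift p (a i + u i) t)
            (fun i => dwork p (b i) + shift p (b i + w i) t) m : ZMod p) else 0 := by
      intro s hs
      rw [hT, Finset.mem_filter, Finset.mem_range] at hs
      rw [PowerSeries.coeff_C_mul, coeff_X_pow_mul_pow _ (by simpa using hs.1) (by simpa using ht)]
      split_ifs with hst
      · subst hst
        rw [redSeries, PowerSeries.coeff_mk]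
      · rw [mul_zero]
    rw [Finset.sum_congr rfl hcoeff, Finset.sum_ite_eq', redSeries, PowerSeries.coeff_mk, pow_one]
    obtain ⟨V, hVc, hV⟩ := hc t ht m
    have hint := hD.integral_shift (u := fun i => shift p (a i + u i) t)
      (w := fun i => shift p (b i + w i) t) (fun i => shift_le_one _ _)
      (fun i => shift_le_one _ _) m
    have hle := sum_shift_le ha' hb' hDa hDb ht.le (h.integral_shift hadm.u_le hadm.w_le t)
    obtain ⟨k, hk⟩ := Nat.exists_eq_add_of_le hle
    rw [hk, pow_add, mul_assoc, mul_assoc] at hV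
    rw [mul_left_cancel₀ (pow_ne_zero _ hp0) hV,
      show (p : ℚ) ^ k = ((p ^ k : ℕ) : ℚ) by push_cast; rfl,
      cast_mul (natCast_mem_ZLoc p _) (mul_mem hint V.2), cast_mul hint V.2, ← red_apply, hVc,
      Rat.cast_natCast]
    split_ifs with htT
    · have : k = 0 := by
        rw [hT, Finset.mem_filter] at htT
        omega
      rw [this]; simp [mul_comm]
    · have : k ≠ 0 := by
        rintro rfl
        exact htT (Finset.mem_filter.2 ⟨Finset.mem_range.2 ht, by omega⟩)
      simp [this]

end

/-! ### Iteration over the orbit of Dwork's map -/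

section

variable {p : ℕ} [hp : Fact p.Prime] {n : ℕ}

theorem iterate_dworkVec (k : ℕ) {n : ℕ} (a : Fin n → ℚ) (i : Fin n) :
    (dworkVec p)^[k] a i = (dwork p)^[k] (a i) := by
  induction k generalizing a with
  | zero => rfl
  | succ k ih => rw [Function.iterate_succ_apply, Function.iterate_succ_apply, ih, dworkVec]

theorem dwork_pos_le_one {γ : ℚ} (h : 0 < γ ∧ γ ≤ 1) : 0 < dwork p γ ∧ dwork p γ ≤ 1 := by
  have hp0 : (0 : ℚ) < p := by exact_mod_cast hp.out.pos
  have h1 := mul_dwork (p := p) γ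
  have h2 : ((digit p γ : ℕ) : ℚ) + 1 ≤ p := by exact_mod_cast digit_lt (p := p) γ
  have h3 : (0 : ℚ) ≤ digit p γ := by positivity
  constructor
  · by_contra! hle
    nlinarith [h.1, mul_nonneg hp0.le (neg_nonneg.2 hle)]
  · by_contra! hlt
    nlinarith [h.2, mul_lt_mul_of_pos_left hlt hp0]

theorem iterate_dwork_pos_le_one (k : ℕ) {γ : ℚ} (h : 0 < γ ∧ γ ≤ 1) :
    0 < (dwork p)^[k] γ ∧ (dwork p)^[k] γ ≤ 1 := by
  induction k with
  | zero => exact h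
  | succ k ih => rw [Function.iterate_succ_apply']; exact dwork_pos_le_one ih

theorem iterate_dwork_mem (k : ℕ) {γ : ℚ} (h : γ ∈ ZLoc p) : (dwork p)^[k] γ ∈ ZLoc p := by
  induction k with
  | zero => exact h
  | succ k ih => rw [Function.iterate_succ_apply']; exact dwork_mem p ih

theorem pow_mul_iterate_dwork (k : ℕ) (γ : ℚ) :
    ∃ z : ℤ, (p : ℚ) ^ k * (dwork p)^[k] γ = γ + z := by
  induction k with
  | zero => exact ⟨0, by simp⟩
  | succ k ih =>
    obtain ⟨z, hz⟩ := ih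
    refine ⟨z + p ^ k * digit p ((dwork p)^[k] γ), ?_⟩
    rw [Function.iterate_succ_apply', pow_succ, mul_assoc, mul_dwork, mul_add, hz]
    push_cast
    ring

/-- `𝔇_p` permutes the rationals of `(0, 1]` with a given denominator `d` prime to `p`, and its
`l`-th iterate is the identity if `p ^ l ≡ 1 mod d`. -/
theorem iterate_dwork_eq_self {γ : ℚ} (h : 0 < γ ∧ γ ≤ 1) (hmem : γ ∈ ZLoc p) {l : ℕ}
    (hl : (p : ZMod γ.den) ^ l = 1) : (dwork p)^[l] γ = γ := by
  obtain ⟨z, hz⟩ := pow_mul_iterate_dwork (p := p) l γ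
  have hd : (γ.den : ℤ) ∣ p ^ l - 1 := by
    rw [← ZMod.intCast_zmod_eq_zero_iff_dvd]
    push_cast
    rw [hl, sub_self]
  obtain ⟨e, he⟩ := hd
  have hγ : (γ.den : ℚ) * γ = γ.num := by rw [mul_comm]; exact Rat.mul_den_eq_num γ
  have hx : (p : ℚ) ^ l * ((dwork p)^[l] γ - γ) = ((z - e * γ.num : ℤ) : ℚ) := by
    have he' : (p : ℚ) ^ l - 1 = γ.den * e := by exact_mod_cast he
    push_cast
    linear_combination hz - γ * he' - (e : ℚ) * hγ
  set x := (dwork p)^[l] γ - γ with hxdef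
  have hxmem : x ∈ ZLoc p := sub_mem (iterate_dwork_mem l hmem) hmem
  -- the denominator of `x` is prime to `p` and divides a power of `p`
  have hden : x.den = 1 := by
    have hco : Nat.Coprime x.den (p ^ l) :=
      (Nat.Coprime.pow_left l ((Nat.Prime.coprime_iff_not_dvd hp.out).2 hxmem)).symm
    have hx2 : (x.num : ℤ) * p ^ l = (z - e * γ.num) * x.den := by
      have h1 : (x.den : ℚ) * x = x.num := by rw [mul_comm]; exact Rat.mul_den_eq_num x
      have : ((x.num * p ^ l : ℤ) : ℚ) = (((z - e * γ.num) * x.den : ℤ) : ℚ) := by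
        rw [Int.cast_mul (z - _), ← hx]
        push_cast
        rw [← h1]
        ring
      exact_mod_cast this
    have hdvd : (x.den : ℤ) ∣ x.num * p ^ l := ⟨_, by rw [hx2, mul_comm]⟩
    have hdvd' : x.den ∣ x.num.natAbs * p ^ l := by
      have := Int.natAbs_dvd_natAbs.2 hdvd
      simpa [Int.natAbs_mul, Int.natAbs_pow] using this
    exact Nat.Coprime.eq_one_of_dvd hco
      (Nat.Coprime.dvd_of_dvd_mul_left x.reduced.symm hdvd')
  have hxz : x = x.num := by
    conv_lhs => rw [← Rat.num_div_den x, hden]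
    simp
  have hb := iterate_dwork_pos_le_one (p := p) l h
  have h1 : (x.num : ℚ) < 1 := by rw [← hxz, hxdef]; linarith [hb.2, h.1]
  have h2 : (-1 : ℚ) < x.num := by rw [← hxz, hxdef]; linarith [hb.1, h.2]
  have h3 : x.num < 1 := by exact_mod_cast h1
  have h4 : -1 < x.num := by exact_mod_cast h2
  have h5 : x = 0 := by rw [hxz, show x.num = 0 by omega]; simp
  rw [hxdef] at h5
  linarith

theorem dwork_one : dwork p 1 = 1 := by
  have hp0 : (p : ℚ) ≠ 0 := by exact_mod_cast hp.out.ne_zero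
  apply mul_left_cancel₀ hp0
  rw [mul_dwork, digit_one, Nat.cast_sub hp.out.one_lt.le]
  simp

/-- If the series with parameters `a`, `b` is integral, so is the one with parameters `𝔇_p(a)`,
`𝔇_p(b)`: up to units its coefficients are those of index `pm` of the former. -/
theorem integral_dwork {n : ℕ} {a b : Fin n → ℚ} (ha : ∀ i, a i ∈ ZLoc p)
    (hb : ∀ i, b i ∈ ZLoc p) (hDa : ∀ i, IsUnitLoc p (dwork p (a i)))
    (hDb : ∀ i, IsUnitLoc p (dwork p (b i))) (hint : ∀ m, hypCoeff a b m ∈ ZLoc p) (m : ℕ) :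
    hypCoeff (dworkVec p a) (dworkVec p b) m ∈ ZLoc p := by
  obtain ⟨c, hc, hV⟩ := hypCoeff_mul_add ha hb hDa hDb (r := 0) (Nat.zero_le _)
  obtain ⟨V, hVc, hV⟩ := hV m
  simp only [shift, not_lt_zero, if_false, Finset.sum_const_zero, pow_zero, one_mul,
    Nat.cast_zero, add_zero] at hV
  have hu : IsUnit V := isUnit_of_red_ne_zero (by rwa [hVc])
  obtain ⟨W, hW⟩ := hu.exists_right_inv
  have hW' : (V : ℚ) * W = 1 := congrArg Subtype.val hW
  have : hypCoeff (dworkVec p a) (dworkVec p b) m = hypCoeff a b (p * m) * W := by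
    rw [hV, mul_assoc, hW', mul_one]
    rfl
  rw [this]
  exact mul_mem (hint _) W.2

/-- The shifts attached to `r < p` at one level are admissible at the next. -/
theorem admissible_shift {b : Fin (n + 1) → ℚ} (a : Fin (n + 1) → ℚ)
    (hlast : b (Fin.last n) = 1)
    (hinj : ∀ i j, dwork p (b i) = dwork p (b j) → b i = b j) {r : ℕ} (hr : r < p) :
    Admissible (dworkVec p b) (fun i => shift p (a i) r) (fun i => shift p (b i) r) where
  u_le _ := shift_le_one _ _
  w_le _ := shift_le_one _ _
  w_eq i j h := by rw [hinj i j h]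
  last := by rw [hlast, shift, digit_one, if_neg (by omega)]

theorem lt_of_mem_sSet {n : ℕ} {a b : Fin n → ℚ} {r : ℕ} (h : r ∈ sSet a b p) : r < p := by
  unfold sSet expSet at h
  simp only [Finset.mem_filter, Finset.mem_range] at h
  exact h.1.1

instance expChar_powerSeries : ExpChar (ZMod p)⟦X⟧ p :=
  expChar_of_injective_algebraMap (algebraMap (ZMod p) (ZMod p)⟦X⟧).injective p

/-- Iteration of `Good.redSeries_eq_sum`, over `k + 1` levels. -/
theorem redSeries_eq_sum_iterate {a b : Fin (n + 1) → ℚ} {l : ℕ}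
    (hG : ∀ k ≤ l, Good p ((dworkVec p)^[k] a) ((dworkVec p)^[k] b))
    (hcl : ∀ k ≤ l, ∀ i j, (dworkVec p)^[k] b i = (dworkVec p)^[k] b j → b i = b j)
    {u w : Fin (n + 1) → ℕ} (hadm : Admissible b u w) (k : ℕ) (hk : k + 1 ≤ l) :
    ∃ P : ℕ → (ZMod p)[X], (∀ r, (P r).natDegree ≤ p ^ (k + 1) - 1) ∧
      redSeries p (fun i => a i + u i) (fun i => b i + w i) =
        ∑ r ∈ sSet ((dworkVec p)^[k] a) ((dworkVec p)^[k] b) p, (P r : (ZMod p)⟦X⟧) *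
          redSeries p
            (fun i => (dworkVec p)^[k + 1] a i + shift p ((dworkVec p)^[k] a i) r)
            (fun i => (dworkVec p)^[k + 1] b i + shift p ((dworkVec p)^[k] b i) r) ^
              p ^ (k + 1) := by
  induction k with
  | zero =>
    obtain ⟨P, hP, h⟩ := (hG 0 (Nat.zero_le _)).redSeries_eq_sum (hG 1 hk) hadm
    exact ⟨P, by simpa using hP, by simpa [dworkVec] using h⟩
  | succ k ih =>
    obtain ⟨P, hP, h⟩ := ih (by omega)
    have step : ∀ r, ∃ P' : ℕ → (ZMod p)[X],
        r ∈ sSet ((dworkVec p)^[k] a) ((dworkVec p)^[k] b) p →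
        (∀ s, (P' s).natDegree ≤ p - 1) ∧
        redSeries p
            (fun i => (dworkVec p)^[k + 1] a i + shift p ((dworkVec p)^[k] a i) r)
            (fun i => (dworkVec p)^[k + 1] b i + shift p ((dworkVec p)^[k] b i) r) =
        ∑ s ∈ sSet ((dworkVec p)^[k + 1] a) ((dworkVec p)^[k + 1] b) p,
          (P' s : (ZMod p)⟦X⟧) * redSeries p
            (fun i => (dworkVec p)^[k + 2] a i + shift p ((dworkVec p)^[k + 1] a i) s)
            (fun i => (dworkVec p)^[k + 2] b i + shift p ((dworkVec p)^[k + 1] b i) s) ^ p := by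
      intro r
      by_cases hr : r ∈ sSet ((dworkVec p)^[k] a) ((dworkVec p)^[k] b) p
      · have hadm' : Admissible ((dworkVec p)^[k + 1] b)
            (fun i => shift p ((dworkVec p)^[k] a i) r)
            (fun i => shift p ((dworkVec p)^[k] b i) r) := by
          rw [Function.iterate_succ_apply']
          refine admissible_shift _ (hG k (by omega)).last (fun i j hij => ?_) (lt_of_mem_sSet hr)
          have := hcl (k + 1) (by omega) i j
            (by rw [Function.iterate_succ_apply']; exact hij)
          rw [iterate_dworkVec, iterate_dworkVec, this]
        have h2 := hG (k + 2) (by omega)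
        rw [Function.iterate_succ_apply' _ (k + 1), Function.iterate_succ_apply' _ (k + 1)] at h2
        obtain ⟨P', hP', h'⟩ := (hG (k + 1) (by omega)).redSeries_eq_sum h2 hadm'
        refine ⟨P', fun _ => ⟨hP', ?_⟩⟩
        rw [h', Function.iterate_succ_apply' _ (k + 1), Function.iterate_succ_apply' _ (k + 1)]
        rfl
      · exact ⟨0, fun h => absurd h hr⟩
    choose P' hP' using step
    refine ⟨fun s => ∑ r ∈ sSet ((dworkVec p)^[k] a) ((dworkVec p)^[k] b) p,
      P r * P' r s ^ p ^ (k + 1), fun s => ?_, ?_⟩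
    · refine Polynomial.natDegree_sum_le_of_forall_le _ _ fun r hr => ?_
      refine Polynomial.natDegree_mul_le.trans ((Nat.add_le_add (hP r)
        (Polynomial.natDegree_pow_le.trans (Nat.mul_le_mul_left _ ((hP' r hr).1 s)))).trans ?_)
      have hq : 1 ≤ p ^ (k + 1) := Nat.one_le_pow _ _ hp.out.pos
      obtain ⟨c, hc⟩ : ∃ c, p = c + 1 := ⟨p - 1, by have := hp.out.pos; omega⟩
      rw [pow_succ p (k + 1)]
      have : p ^ (k + 1) * p = p ^ (k + 1) * (p - 1) + p ^ (k + 1) := by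
        nth_rewrite 2 [hc]
        nth_rewrite 3 [hc]
        rw [Nat.add_sub_cancel, mul_add, mul_one]
      omega
    · rw [h, Finset.sum_congr rfl fun r hr => by rw [(hP' r hr).2, sum_pow_char_pow,
        Finset.mul_sum], Finset.sum_comm]
      refine Finset.sum_congr rfl fun s _ => ?_
      rw [← Polynomial.coeToPowerSeries.ringHom_apply, map_sum, Finset.sum_mul]
      refine Finset.sum_congr rfl fun r _ => ?_
      rw [Polynomial.coeToPowerSeries.ringHom_apply, Polynomial.coe_mul, Polynomial.coe_pow,
        mul_pow, ← pow_mul, ← pow_succ', mul_assoc]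

/-- The property `P_{p,l}` gives `Good` at every level. -/
theorem good_iterate {a b : Fin (n + 1) → ℚ}
    (hα : ∀ i, 0 < a i ∧ a i ≤ 1) (hβ : ∀ i, 0 < b i ∧ b i ≤ 1)
    (hlast : b (Fin.last n) = 1) (hint : ∀ i, hypCoeff a b i ∈ ZLoc p)
    {l : ℕ} (hl : 1 ≤ l) (hP : PProp a b p l)
    (hpa : ∀ i, (dwork p)^[l] (a i) = a i) (hpb : ∀ i, (dwork p)^[l] (b i) = b i)
    (k : ℕ) (hk : k ≤ l) :
    Good p ((dworkVec p)^[k] a) ((dworkVec p)^[k] b) := by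
  have hpa' : (dworkVec p)^[l] a = a := funext fun i => by rw [iterate_dworkVec, hpa]
  have hpb' : (dworkVec p)^[l] b = b := funext fun i => by rw [iterate_dworkVec, hpb]
  suffices H : ∀ k < l, Good p ((dworkVec p)^[k] a) ((dworkVec p)^[k] b) by
    rcases hk.lt_or_eq with h | rfl
    · exact H k h
    · rw [hpa', hpb']; exact H 0 hl
  intro k hk
  have hone : ∀ k, (dwork p)^[k] (1 : ℚ) = 1 := fun k => by
    induction k with
    | zero => rfl
    | succ k ih => rw [Function.iterate_succ_apply, dwork_one, ih]
  -- level `0` is level `l`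
  obtain ⟨k', hk1, hkl, hka, hkb⟩ : ∃ k', 1 ≤ k' ∧ k' ≤ l ∧
      (∀ i, (dworkVec p)^[k] a i = (dwork p)^[k'] (a i)) ∧
      ∀ i, (dworkVec p)^[k] b i = (dwork p)^[k'] (b i) := by
    rcases Nat.eq_zero_or_pos k with rfl | hpos
    · exact ⟨l, hl, le_rfl, fun i => (hpa i).symm, fun i => (hpb i).symm⟩
    · exact ⟨k, hpos, hk.le, fun i => iterate_dworkVec k a i, fun i => iterate_dworkVec k b i⟩
  refine
    { a_pos := fun i => by rw [hka]; exact (iterate_dwork_pos_le_one k' (hα i)).1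
      b_pos := fun i => by rw [hkb]; exact (iterate_dwork_pos_le_one k' (hβ i)).1
      a_unit := fun i => by rw [hka]; exact (hP.P1 k' hk1 hkl i).1
      b_unit := fun i => by rw [hkb]; exact (hP.P1 k' hk1 hkl i).2
      sub_unit := fun i j => by rw [hka, hkb]; exact hP.P2 k' hk1 hkl i j
      one_sub_add_left := fun i j => by rw [hka, hkb]; exact (hP.P5 k' hk1 hkl i j).1
      one_sub_add_right := fun i j => by rw [hkb, hkb]; exact (hP.P5 k' hk1 hkl i j).2
      b_ne := fun i j hij => by
        rw [hkb, hkb] at hij ⊢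
        exact (hP.P3 k' hk1 hkl i j).2 fun h => hij (by rw [h])
      last := by rw [hkb, hlast, hone]
      digit_b := fun j hj => ?_
      integral := ?_ }
  · intro hd
    rw [iterate_dworkVec] at hj hd
    have h4 := hP.P4 (k + 1) (by omega) (by omega) j fun h => hj (by rw [h, hone])
    apply h4
    rw [Nat.add_sub_cancel, Function.iterate_succ_apply', mul_dwork, hd,
      Nat.cast_sub hp.out.one_lt.le]
    simp
  · clear hka hkb hk1 hkl
    clear k'
    induction k with
    | zero => exact hint
    | succ k ih =>
      rw [Function.iterate_succ_apply', Function.iterate_succ_apply']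
      refine integral_dwork ?_ ?_ ?_ ?_ (ih (by omega))
      · intro i; rw [iterate_dworkVec]; exact iterate_dwork_mem k (hP.mem_left i)
      · intro i; rw [iterate_dworkVec]; exact iterate_dwork_mem k (hP.mem_right i)
      · intro i
        rw [iterate_dworkVec, ← Function.iterate_succ_apply' (dwork p)]
        exact (hP.P1 (k + 1) (by omega) (by omega) i).1
      · intro i
        rw [iterate_dworkVec, ← Function.iterate_succ_apply' (dwork p)]
        exact (hP.P1 (k + 1) (by omega) (by omega) i).2

/-- The Frobenius system over `𝔽_p` satisfied by the reduction of the series: it belongs to a family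
indexed by `S`, each member of which is a combination of the `p ^ l`-th powers of all of them, with
polynomial coefficients of degree less than `p ^ l`. -/
theorem exists_frobenius_system {a b : Fin (n + 1) → ℚ}
    (hα : ∀ i, 0 < a i ∧ a i ≤ 1) (hβ : ∀ i, 0 < b i ∧ b i ≤ 1)
    (hlast : b (Fin.last n) = 1) (hint : ∀ i, hypCoeff a b i ∈ ZLoc p)
    {l : ℕ} (hl : 1 ≤ l) (hP : PProp a b p l)
    (hpa : ∀ i, (dwork p)^[l] (a i) = a i) (hpb : ∀ i, (dwork p)^[l] (b i) = b i) :
    ∃ (y : ℕ → (ZMod p)⟦X⟧) (C : ℕ → ℕ → (ZMod p)[X]),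
      y 0 = redSeries p a b ∧
      0 ∈ sSet ((dworkVec p)^[l - 1] a) ((dworkVec p)^[l - 1] b) p ∧
      (∀ r s, (C r s).natDegree ≤ p ^ l - 1) ∧
      ∀ r ∈ sSet ((dworkVec p)^[l - 1] a) ((dworkVec p)^[l - 1] b) p,
        y r = ∑ s ∈ sSet ((dworkVec p)^[l - 1] a) ((dworkVec p)^[l - 1] b) p,
          (C r s : (ZMod p)⟦X⟧) * y s ^ p ^ l := by
  have hG := good_iterate hα hβ hlast hint hl hP hpa hpb
  have hcl : ∀ k ≤ l, ∀ i j, (dworkVec p)^[k] b i = (dworkVec p)^[k] b j → b i = b j := by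
    intro k hk i j hij
    rcases Nat.eq_zero_or_pos k with rfl | hpos
    · exact hij
    · by_contra hne
      have hu := (hP.P3 k hpos hk i j).2 hne
      rw [iterate_dworkVec, iterate_dworkVec] at hij
      rw [hij, sub_self, isUnitLoc_iff] at hu
      exact hu.2 Rat.cast_zero
  have hpa' : (dworkVec p)^[l] a = a := funext fun i => by rw [iterate_dworkVec, hpa]
  have hpb' : (dworkVec p)^[l] b = b := funext fun i => by rw [iterate_dworkVec, hpb]
  obtain ⟨k, rfl⟩ : ∃ k, l = k + 1 := ⟨l - 1, by omega⟩
  have hsys : ∀ r, ∃ P : ℕ → (ZMod p)[X], (∀ s, (P s).natDegree ≤ p ^ (k + 1) - 1) ∧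
      (r ∈ sSet ((dworkVec p)^[k] a) ((dworkVec p)^[k] b) p →
        redSeries p (fun i => a i + shift p ((dworkVec p)^[k] a i) r)
          (fun i => b i + shift p ((dworkVec p)^[k] b i) r) =
        ∑ s ∈ sSet ((dworkVec p)^[k] a) ((dworkVec p)^[k] b) p, (P s : (ZMod p)⟦X⟧) *
          redSeries p (fun i => a i + shift p ((dworkVec p)^[k] a i) s)
            (fun i => b i + shift p ((dworkVec p)^[k] b i) s) ^ p ^ (k + 1)) := by
    intro r
    by_cases hr : r ∈ sSet ((dworkVec p)^[k] a) ((dworkVec p)^[k] b) p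
    · have hadm : Admissible b (fun i => shift p ((dworkVec p)^[k] a i) r)
          (fun i => shift p ((dworkVec p)^[k] b i) r) := by
        have := admissible_shift ((dworkVec p)^[k] a) (hG k (by omega)).last
          (fun i j hij => ?_) (lt_of_mem_sSet hr)
        · rwa [← Function.iterate_succ_apply' (dworkVec p), hpb'] at this
        · have := hcl (k + 1) le_rfl i j (by rw [Function.iterate_succ_apply']; exact hij)
          rw [iterate_dworkVec, iterate_dworkVec, this]
      obtain ⟨P, hP', h⟩ := redSeries_eq_sum_iterate hG hcl hadm k le_rfl
      rw [hpa', hpb'] at h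
      exact ⟨P, hP', fun _ => h⟩
    · exact ⟨0, by simp, fun h => absurd h hr⟩
  choose C hC hsys using hsys
  refine ⟨fun r => redSeries p (fun i => a i + shift p ((dworkVec p)^[k] a i) r)
    (fun i => b i + shift p ((dworkVec p)^[k] b i) r), C, ?_,
    zero_mem_sSet (hG k (by omega)).last, hC, hsys⟩
  simp [shift]

end

/-! ### From a Frobenius system to a relation between Frobenius powers -/

section

variable {p : ℕ} [hp : Fact p.Prime]

/-- The iterates of a Frobenius system, raised to a power `q ^ i`. -/
theorem frobenius_system_iterate {S : Finset ℕ} {y : ℕ → (ZMod p)⟦X⟧} {C : ℕ → ℕ → (ZMod p)[X]}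
    {l : ℕ} (hC : ∀ r s, (C r s).natDegree ≤ p ^ l - 1)
    (hy : ∀ r ∈ S, y r = ∑ s ∈ S, (C r s : (ZMod p)⟦X⟧) * y s ^ p ^ l)
    {r : ℕ} (hr : r ∈ S) (k i : ℕ) :
    ∃ M : ℕ → (ZMod p)[X], (∀ s, (M s).natDegree ≤ p ^ (l * (k + i)) - 1) ∧
      y r ^ p ^ (l * i) = ∑ s ∈ S, (M s : (ZMod p)⟦X⟧) * y s ^ p ^ (l * (k + i)) := by
  classical
  have hpos : ∀ j, 1 ≤ p ^ j := fun j => Nat.one_le_pow _ _ hp.out.pos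
  induction k with
  | zero =>
    refine ⟨fun s => if s = r then 1 else 0, fun s => ?_, ?_⟩
    · dsimp only; split_ifs <;> simp
    · rw [Finset.sum_eq_single r]
      · simp
      · intro s _ hs; simp [hs]
      · intro h; exact absurd hr h
  | succ k ih =>
    obtain ⟨M, hM, h⟩ := ih
    refine ⟨fun t => ∑ s ∈ S, M s * C s t ^ p ^ (l * (k + i)), fun t => ?_, ?_⟩
    · refine Polynomial.natDegree_sum_le_of_forall_le _ _ fun s _ => ?_
      refine Polynomial.natDegree_mul_le.trans ((Nat.add_le_add (hM s)
        (Polynomial.natDegree_pow_le.trans (Nat.mul_le_mul_left _ (hC s t)))).trans ?_)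
      have e : p ^ (l * (k + 1 + i)) = p ^ (l * (k + i)) * p ^ l := by rw [← pow_add]; ring
      have h1 := hpos (l * (k + i))
      have h2 := hpos l
      rw [e, Nat.mul_sub, mul_one]
      have := Nat.le_mul_of_pos_right (p ^ (l * (k + i))) h2
      omega
    · have hs : ∀ s ∈ S, (M s : (ZMod p)⟦X⟧) * y s ^ p ^ (l * (k + i)) =
          ∑ t ∈ S, (M s : (ZMod p)⟦X⟧) *
            ((C s t : (ZMod p)⟦X⟧) * y t ^ p ^ l) ^ p ^ (l * (k + i)) := by
        intro s hs
        conv_lhs => rw [hy s hs]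
        rw [sum_pow_char_pow, Finset.mul_sum]
      rw [h, Finset.sum_congr rfl hs, Finset.sum_comm]
      refine Finset.sum_congr rfl fun t _ => ?_
      rw [← Polynomial.coeToPowerSeries.ringHom_apply, map_sum, Finset.sum_mul]
      refine Finset.sum_congr rfl fun s _ => ?_
      rw [Polynomial.coeToPowerSeries.ringHom_apply, Polynomial.coe_mul, Polynomial.coe_pow,
        mul_pow, ← pow_mul, ← pow_add, mul_assoc,
        show l + l * (k + i) = l * (k + 1 + i) by ring]

/-- `N + 1` vectors of `N` polynomials of degree at most `B` are linearly dependent over the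
polynomials, with coefficients of degree at most `N * B`. -/
theorem exists_polynomial_relation {K : Type*} [Field K] (S : Finset ℕ) (B : ℕ)
    (M : ℕ → ℕ → K[X]) (hM : ∀ i s, (M i s).natDegree ≤ B) :
    ∃ c : ℕ → K[X], (∀ i, (c i).natDegree ≤ S.card * B) ∧ (∀ i, S.card < i → c i = 0) ∧
      (∃ i, c i ≠ 0) ∧ ∀ s ∈ S, ∑ i ∈ Finset.range (S.card + 1), c i * M i s = 0 := by
  set N := S.card with hN
  set D := N * B with hD
  have hmem : ∀ (c : Fin (N + 1) → Polynomial.degreeLT K (D + 1)) (s : S),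
      ∑ i, (c i : K[X]) * M i s ∈ Polynomial.degreeLT K (D + 1 + B) := by
    intro c s
    refine Submodule.sum_mem _ fun i _ => ?_
    rw [Polynomial.mem_degreeLT]
    by_cases h0 : (c i : K[X]) * M i s = 0
    · rw [h0, Polynomial.degree_zero]; exact WithBot.bot_lt_coe _
    · rw [← Polynomial.natDegree_lt_iff_degree_lt h0]
      have h1 := Polynomial.mem_degreeLT.1 (c i).2
      rw [← Polynomial.natDegree_lt_iff_degree_lt (left_ne_zero_of_mul h0)] at h1
      have := Polynomial.natDegree_mul_le (p := (c i : K[X])) (q := M i s)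
      have := hM i s
      omega
  let Φ : (Fin (N + 1) → Polynomial.degreeLT K (D + 1)) →ₗ[K]
      (S → Polynomial.degreeLT K (D + 1 + B)) :=
    { toFun := fun c s => ⟨∑ i, (c i : K[X]) * M i s, hmem c s⟩
      map_add' := fun c d => by
        funext s; apply Subtype.ext; simp [add_mul, Finset.sum_add_distrib]
      map_smul' := fun a c => by
        funext s; apply Subtype.ext; simp [Finset.smul_sum] }
  have hfr : ∀ m, Module.finrank K (Polynomial.degreeLT K m) = m := fun m => by
    rw [(Polynomial.degreeLTEquiv K m).finrank_eq, Module.finrank_fin_fun]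
  have hfd : ∀ m, Module.Finite K (Polynomial.degreeLT K m) := fun m =>
    Module.Finite.equiv (Polynomial.degreeLTEquiv K m).symm
  have hker : LinearMap.ker Φ ≠ ⊥ := by
    apply LinearMap.ker_ne_bot_of_finrank_lt
    rw [Module.finrank_pi_fintype, Module.finrank_pi_fintype]
    simp only [hfr, Finset.sum_const, Finset.card_univ, Fintype.card_fin, Fintype.card_coe,
      smul_eq_mul, ← hN]
    rw [hD]
    ring_nf
    omega
  obtain ⟨c, hc, hc0⟩ := Submodule.exists_mem_ne_zero_of_ne_bot hker
  refine ⟨fun i => if h : i < N + 1 then (c ⟨i, h⟩ : K[X]) else 0, fun i => ?_, fun i hi => ?_,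
    ?_, fun s hs => ?_⟩
  · dsimp only
    split_ifs with h
    · have h1 := Polynomial.mem_degreeLT.1 (c ⟨i, h⟩).2
      by_cases h0 : (c ⟨i, h⟩ : K[X]) = 0
      · simp [h0]
      · rw [← Polynomial.natDegree_lt_iff_degree_lt h0] at h1
        omega
    · simp
  · exact dif_neg (by omega)
  · obtain ⟨i, hi⟩ := Function.ne_iff.1 hc0
    refine ⟨i, ?_⟩
    simp only [Fin.is_lt, dif_pos, Fin.eta]
    exact fun h => hi (Subtype.ext h)
  · have h1 := congrArg Subtype.val (congrFun (LinearMap.mem_ker.1 hc) ⟨s, hs⟩)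
    rw [Finset.sum_range]
    refine Eq.trans (Finset.sum_congr rfl fun i _ => ?_) h1
    simp only [Fin.is_lt, dif_pos, Fin.eta]

/-- The section `∑ h_k z^k ↦ ∑ h_{qm+t} z^m` of the map `g ↦ z^t g(z^q)` (a Cartier operator), for
`q = p ^ l`. -/
def cartier (p l t : ℕ) (h : (ZMod p)⟦X⟧) : (ZMod p)⟦X⟧ :=
  PowerSeries.mk fun m => PowerSeries.coeff (p ^ l * m + t) h

theorem eq_sum_cartier (l : ℕ) (h : (ZMod p)⟦X⟧) :
    h = ∑ t ∈ Finset.range (p ^ l), PowerSeries.X ^ t * cartier p l t h ^ p ^ l := by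
  have hq : 0 < p ^ l := pow_pos hp.out.pos _
  ext k
  obtain ⟨m, s, hs, rfl⟩ : ∃ m s, s < p ^ l ∧ k = p ^ l * m + s :=
    ⟨k / p ^ l, k % p ^ l, Nat.mod_lt _ hq, by rw [Nat.div_add_mod]⟩
  rw [map_sum, Finset.sum_congr rfl fun t ht =>
    coeff_X_pow_mul_pow _ (Finset.mem_range.1 ht) hs m, Finset.sum_ite_eq',
    if_pos (Finset.mem_range.2 hs), cartier, PowerSeries.coeff_mk]

theorem cartier_mul_pow {l t : ℕ} (ht : t < p ^ l) (h g : (ZMod p)⟦X⟧) :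
    cartier p l t (h * g ^ p ^ l) = cartier p l t h * g := by
  ext m
  rw [cartier, PowerSeries.coeff_mk]
  conv_lhs => rw [eq_sum_cartier l h]
  rw [Finset.sum_mul, map_sum]
  simp only [mul_assoc, ← mul_pow]
  rw [Finset.sum_congr rfl fun s hs =>
    coeff_X_pow_mul_pow _ (Finset.mem_range.1 hs) ht m, Finset.sum_ite_eq',
    if_pos (Finset.mem_range.2 ht)]

theorem cartier_sum {ι : Type*} (s : Finset ι) (l t : ℕ) (h : ι → (ZMod p)⟦X⟧) :
    cartier p l t (∑ i ∈ s, h i) = ∑ i ∈ s, cartier p l t (h i) := by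
  ext m
  simp [cartier]

theorem exists_cartier_eq_coe (l t : ℕ) (c : (ZMod p)[X]) :
    ∃ d : (ZMod p)[X], d.natDegree ≤ c.natDegree ∧ (d : (ZMod p)⟦X⟧) = cartier p l t c := by
  have hq : 0 < p ^ l := pow_pos hp.out.pos _
  refine ⟨∑ m ∈ Finset.range (c.natDegree + 1),
    Polynomial.monomial m (c.coeff (p ^ l * m + t)), ?_, ?_⟩
  · refine Polynomial.natDegree_sum_le_of_forall_le _ _ fun m hm =>
      (Polynomial.natDegree_monomial_le _).trans ?_
    have := Finset.mem_range.1 hm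
    omega
  · ext m
    rw [Polynomial.coeff_coe, Polynomial.finsetSum_coeff, cartier, PowerSeries.coeff_mk,
      Polynomial.coeff_coe]
    simp only [Polynomial.coeff_monomial]
    rw [Finset.sum_ite_eq']
    split_ifs with h
    · rfl
    · rw [Polynomial.coeff_eq_zero_of_natDegree_lt]
      rw [Finset.mem_range] at h
      have := Nat.le_mul_of_pos_left m hq
      omega

/-- A non-trivial relation between the `f ^ q ^ i` can be divided by Frobenius until the coefficient
of `f` itself is non-zero: the Cartier operators turn `∑ c_i f ^ q ^ i = 0` with `c_0 = 0` into a
relation between the `f ^ q ^ (i - 1)`, and one of them keeps it non-trivial. -/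
theorem exists_relation_ne_zero (f : (ZMod p)⟦X⟧) (l D N : ℕ) (i₀ : ℕ) (c : ℕ → (ZMod p)[X])
    (hdeg : ∀ i, (c i).natDegree ≤ D) (hN : ∀ i, N < i → c i = 0)
    (hlow : ∀ i < i₀, c i = 0) (hne : c i₀ ≠ 0)
    (hrel : ∑ i ∈ Finset.range (N + 1), (c i : (ZMod p)⟦X⟧) * f ^ p ^ (l * i) = 0) :
    ∃ c' : ℕ → (ZMod p)[X], (∀ i, (c' i).natDegree ≤ D) ∧ c' 0 ≠ 0 ∧
      ∑ i ∈ Finset.range (N + 1), (c' i : (ZMod p)⟦X⟧) * f ^ p ^ (l * i) = 0 := by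
  induction i₀ generalizing c with
  | zero => exact ⟨c, hdeg, hne, hrel⟩
  | succ i₀ ih =>
    have hq : 0 < p ^ l := pow_pos hp.out.pos _
    obtain ⟨k, hk⟩ : ∃ k, (c (i₀ + 1)).coeff k ≠ 0 := by
      by_contra! h
      exact hne (Polynomial.ext (by simpa using h))
    have ht : k % p ^ l < p ^ l := Nat.mod_lt _ hq
    choose d hd hd' using fun i => exists_cartier_eq_coe l (k % p ^ l) (c i)
    have hd0 : ∀ i, c i = 0 → d i = 0 := by
      intro i hi
      have h1 := hd' i
      rw [hi] at h1
      apply Polynomial.coe_injective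
      rw [h1]
      ext m
      simp [cartier]
    refine ih (fun i => d (i + 1)) (fun i => (hd _).trans (hdeg _))
      (fun i hi => hd0 _ (hN _ (by omega))) (fun i hi => hd0 _ (hlow _ (by omega))) ?_ ?_
    · intro h0
      have h1 := hd' (i₀ + 1)
      rw [h0, Polynomial.coe_zero] at h1
      have h2 := congrArg (PowerSeries.coeff (k / p ^ l)) h1
      rw [cartier, PowerSeries.coeff_mk, Nat.div_add_mod, Polynomial.coeff_coe] at h2
      exact hk h2.symm
    · rw [Finset.sum_range_succ, hd0 _ (hN _ (Nat.lt_succ_self N)), Polynomial.coe_zero, zero_mul,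
        add_zero]
      rw [Finset.sum_range_succ', hlow 0 (Nat.succ_pos _), Polynomial.coe_zero, zero_mul,
        add_zero] at hrel
      have h1 := congrArg (cartier p l (k % p ^ l)) hrel
      rw [cartier_sum] at h1
      simp only [mul_add, mul_one, pow_add, pow_mul f, cartier_mul_pow ht, ← hd'] at h1
      rw [h1]
      ext m
      simp [cartier]

/-- A member of a Frobenius system of size `N` satisfies a relation `∑_{i ≤ N} c_i f ^ q ^ i = 0`
with `c_0 ≠ 0` and coefficients of degree at most `N (q ^ N - 1)`. -/
theorem exists_frobenius_relation {S : Finset ℕ} {y : ℕ → (ZMod p)⟦X⟧}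
    {C : ℕ → ℕ → (ZMod p)[X]} {l : ℕ} (hC : ∀ r s, (C r s).natDegree ≤ p ^ l - 1)
    (hy : ∀ r ∈ S, y r = ∑ s ∈ S, (C r s : (ZMod p)⟦X⟧) * y s ^ p ^ l)
    {r : ℕ} (hr : r ∈ S) :
    ∃ c : ℕ → (ZMod p)[X], (∀ i, (c i).natDegree ≤ S.card * (p ^ (l * S.card) - 1)) ∧ c 0 ≠ 0 ∧
      ∑ i ∈ Finset.range (S.card + 1), (c i : (ZMod p)⟦X⟧) * y r ^ p ^ (l * i) = 0 := by
  classical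
  have hM : ∀ i, ∃ M : ℕ → (ZMod p)[X], (∀ s, (M s).natDegree ≤ p ^ (l * S.card) - 1) ∧
      (i ≤ S.card → y r ^ p ^ (l * i) =
        ∑ s ∈ S, (M s : (ZMod p)⟦X⟧) * y s ^ p ^ (l * S.card)) := by
    intro i
    by_cases hi : i ≤ S.card
    · obtain ⟨M, h1, h2⟩ := frobenius_system_iterate hC hy hr (S.card - i) i
      rw [Nat.sub_add_cancel hi] at h1 h2
      exact ⟨M, h1, fun _ => h2⟩
    · exact ⟨0, by simp, fun h => absurd h hi⟩
  choose M hM hM' using hM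
  obtain ⟨c, hc, hcN, hc0, hrel⟩ := exists_polynomial_relation S _ M hM
  refine exists_relation_ne_zero (y r) l _ S.card (Nat.find hc0) c hc hcN
    (fun i hi => not_not.1 (Nat.find_min hc0 hi)) (Nat.find_spec hc0) ?_
  rw [Finset.sum_congr rfl fun i hi => by
    rw [hM' i (Nat.lt_succ_iff.1 (Finset.mem_range.1 hi)), Finset.mul_sum], Finset.sum_comm]
  refine Finset.sum_eq_zero fun s hs => ?_
  simp only [← mul_assoc]
  rw [← Finset.sum_mul]
  have := congrArg (Polynomial.coeToPowerSeries.ringHom (R := ZMod p)) (hrel s hs)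
  simp only [map_sum, map_mul, Polynomial.coeToPowerSeries.ringHom_apply, map_zero] at this
  rw [this, zero_mul]

end

/-! ### Lifting to characteristic zero -/

section

variable {p : ℕ} [hp : Fact p.Prime]

theorem red_surjective : Function.Surjective (red p) := fun x =>
  ⟨(x.val : ZLoc p), by rw [map_natCast, ZMod.natCast_zmod_val]⟩

theorem coeff_single_neg_mul_coe {R : Type*} [CommRing R] (e : ℕ) (P : R⟦X⟧) (m : ℤ) :
    (HahnSeries.single (-(e : ℤ)) (1 : R) * (P : R⸨X⸩)).coeff m =
      if m + e < 0 then 0 else PowerSeries.coeff (m + e).natAbs P := by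
  rw [HahnSeries.coeff_single_mul, one_mul, PowerSeries.coeff_coe, sub_neg_eq_add]

theorem single_neg_mul_coe_X_pow_mul {R : Type*} [CommRing R] (e : ℕ) (P : R⟦X⟧) :
    HahnSeries.single (-(e : ℤ)) (1 : R) * ((PowerSeries.X ^ e * P : R⟦X⟧) : R⸨X⸩) = P := by
  rw [PowerSeries.coe_mul, PowerSeries.coe_pow, PowerSeries.coe_X, HahnSeries.single_pow,
    ← mul_assoc, HahnSeries.single_mul_single]
  simp

/-- The Laurent expansion of a quotient of polynomials whose denominator is `z ^ e` times a
polynomial that is invertible as a power series, computed over any ring from which the coefficients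
are mapped. -/
theorem coe_ratFunc_eq {R K : Type*} [CommRing R] [Field K] (φ : R →+* K) (A B : R[X])
    (J : R⟦X⟧) (hJ : (B : R⟦X⟧) * J = 1) (e : ℕ) :
    ((algebraMap K[X] (RatFunc K) (A.map φ) /
        algebraMap K[X] (RatFunc K) (Polynomial.X ^ e * B.map φ) : RatFunc K) : K⸨X⸩) =
      HahnSeries.single (-(e : ℤ)) (1 : K) *
        ((PowerSeries.map φ ((A : R⟦X⟧) * J) : K⟦X⟧) : K⸨X⸩) := by
  have hBJ : ((B.map φ : K[X]) : K⟦X⟧) * PowerSeries.map φ J = 1 := by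
    rw [Polynomial.polynomial_map_coe, ← map_mul, hJ, map_one]
  have hB : (B.map φ : K[X]) ≠ 0 := by
    intro h
    rw [h, Polynomial.coe_zero, zero_mul] at hBJ
    exact zero_ne_one hBJ
  have hden : algebraMap K[X] (RatFunc K) (Polynomial.X ^ e * B.map φ) ≠ 0 := by
    rw [Ne, map_eq_zero_iff _ (RatFunc.algebraMap_injective K)]
    exact mul_ne_zero (pow_ne_zero _ Polynomial.X_ne_zero) hB
  have hcoe : ∀ P : K[X], ((algebraMap K[X] (RatFunc K) P : RatFunc K) : K⸨X⸩) =
      ((P : K⟦X⟧) : K⸨X⸩) := fun P => (RatFunc.coe_coe P).symm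
  rw [map_div₀, div_eq_iff ((map_ne_zero _).2 hden), hcoe, hcoe, Polynomial.coe_mul,
    Polynomial.coe_pow, Polynomial.coe_X, mul_assoc, ← PowerSeries.coe_mul,
    show PowerSeries.map φ ((A : R⟦X⟧) * J) * (PowerSeries.X ^ e * ((B.map φ : K[X]) : K⟦X⟧)) =
      PowerSeries.X ^ e * ((A.map φ : K[X]) : K⟦X⟧) by
        rw [map_mul, Polynomial.polynomial_map_coe (f := A)]
        linear_combination (PowerSeries.map φ (A : R⟦X⟧) * PowerSeries.X ^ e) * hBJ,
    single_neg_mul_coe_X_pow_mul]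

/-- A Laurent series `z ^ (-e) H` with `H` over `ℤ_(p)` reducing to zero is congruent to zero. -/
theorem laurentCongr_of_red_eq_zero (A B : ℚ⸨X⸩) (H : (ZLoc p)⟦X⟧) (e : ℕ)
    (hAB : A - B = HahnSeries.single (-(e : ℤ)) (1 : ℚ) *
      ((PowerSeries.map (ZLoc p).subtype H : ℚ⟦X⟧) : ℚ⸨X⸩))
    (hH : PowerSeries.map (red p) H = 0) : LaurentCongr p A B := by
  intro m
  unfold CongrLoc
  rw [← HahnSeries.coeff_sub, hAB, coeff_single_neg_mul_coe]
  split_ifs with h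
  · exact ⟨0, zero_mem _, by simp⟩
  · have h1 := congrArg (PowerSeries.coeff (m + e).natAbs) hH
    rw [PowerSeries.coeff_map, map_zero] at h1
    rw [PowerSeries.coeff_map]
    exact exists_of_red_eq_zero _ h1

theorem height_div_le {K : Type*} [Field K] (A B : K[X]) (hB : B ≠ 0) {D : ℕ}
    (hA : A.natDegree ≤ D) (hBD : B.natDegree ≤ D) :
    height (algebraMap K[X] (RatFunc K) A / algebraMap K[X] (RatFunc K) B) ≤ D := by
  refine max_le ?_ ?_
  · by_cases h0 : A = 0
    · simp [h0]
    · exact (Polynomial.natDegree_le_of_dvd (RatFunc.num_div_dvd A hB) h0).trans hA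
  · exact (Polynomial.natDegree_le_of_dvd (RatFunc.denom_div_dvd A B) hB).trans hBD

/-- A relation over `𝔽_p` with `c_0 ≠ 0` lifts to a congruence with coefficients in `ℚ(z)`. The
quotients `-c_i / c_0` are lifted with a denominator `z ^ e B`, `B(0) = 1`, so that the lifts have
Laurent expansions over `ℤ_(p)`. -/
theorem exists_lift_relation (F : (ZLoc p)⟦X⟧) {l N D : ℕ} (c : ℕ → (ZMod p)[X])
    (hc : ∀ i, (c i).natDegree ≤ D) (hc0 : c 0 ≠ 0)
    (hrel : ∑ i ∈ Finset.range (N + 1),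
      (c i : (ZMod p)⟦X⟧) * PowerSeries.map (red p) F ^ p ^ (l * i) = 0) :
    ∃ Q : ℕ → RatFunc ℚ, (∀ i, IsIntegralAt p (Q i) ∧
        ∃ q : RatFunc (ZMod p), ReducesTo p (Q i) q ∧ height q ≤ D) ∧
      LaurentCongr p ((PowerSeries.map (ZLoc p).subtype F : ℚ⟦X⟧) : ℚ⸨X⸩)
        (∑ i ∈ Finset.Icc 1 N, (Q i : ℚ⸨X⸩) *
          ((PowerSeries.map (ZLoc p).subtype F : ℚ⟦X⟧) : ℚ⸨X⸩) ^ p ^ (i * l)) := by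
  obtain ⟨b, hb, hbX⟩ := Polynomial.exists_eq_pow_rootMultiplicity_mul_and_not_dvd (c 0) hc0 0
  set e := (c 0).rootMultiplicity 0
  rw [map_zero, sub_zero] at hb hbX
  rw [Polynomial.X_dvd_iff] at hbX
  set κ := b.coeff 0
  -- the denominator, normalised to have constant term `1`, and a lift with constant term `1`
  set b' := Polynomial.C κ⁻¹ * b with hb'
  have hb'0 : b'.coeff 0 = 1 := by rw [hb', Polynomial.coeff_C_mul, inv_mul_cancel₀ hbX]
  choose lift hlift using Polynomial.map_surjective (red p) red_surjective
  set B := lift b'.divX * Polynomial.X + 1 with hB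
  have hBmap : B.map (red p) = b' := by
    rw [hB, Polynomial.map_add, Polynomial.map_mul, hlift, Polynomial.map_X, Polynomial.map_one]
    conv_rhs => rw [← Polynomial.divX_mul_X_add b', hb'0, map_one]
  obtain ⟨J, hJ⟩ : ∃ J, (B : (ZLoc p)⟦X⟧) * J = 1 := by
    have : IsUnit (B : (ZLoc p)⟦X⟧) := by
      rw [PowerSeries.isUnit_iff_constantCoeff, ← PowerSeries.coeff_zero_eq_constantCoeff_apply,
        Polynomial.coeff_coe, hB]
      simp
    exact this.exists_right_inv
  set A : ℕ → (ZLoc p)[X] := fun i => lift (-(Polynomial.C κ⁻¹ * c i)) with hA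
  have hAmap : ∀ i, (A i).map (red p) = -(Polynomial.C κ⁻¹ * c i) := fun i => hlift _
  have hQ := fun i => coe_ratFunc_eq (ZLoc p).subtype (A i) B J hJ e
  have hq := fun i => coe_ratFunc_eq (red p) (A i) B J hJ e
  have hdegC : ∀ g : (ZMod p)[X], (Polynomial.C κ⁻¹ * g).natDegree ≤ g.natDegree := fun g =>
    Polynomial.natDegree_C_mul_le _ _
  have hden : Polynomial.X ^ e * B.map (red p) = Polynomial.C κ⁻¹ * c 0 := by
    rw [hBmap, hb', hb]; ring
  refine ⟨fun i => algebraMap ℚ[X] (RatFunc ℚ) ((A i).map (ZLoc p).subtype) /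
    algebraMap ℚ[X] (RatFunc ℚ) (Polynomial.X ^ e * B.map (ZLoc p).subtype), fun i => ?_, ?_⟩
  · have hint : IsIntegralAt p (algebraMap ℚ[X] (RatFunc ℚ) ((A i).map (ZLoc p).subtype) /
        algebraMap ℚ[X] (RatFunc ℚ) (Polynomial.X ^ e * B.map (ZLoc p).subtype)) := by
      intro m
      rw [hQ, coeff_single_neg_mul_coe]
      split_ifs with h
      · exact zero_mem _
      · rw [PowerSeries.coeff_map]; exact Subtype.property _
    refine ⟨hint, algebraMap _ _ ((A i).map (red p)) /
      algebraMap _ _ (Polynomial.X ^ e * B.map (red p)), ⟨hint, fun m => ?_⟩, ?_⟩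
    · rw [hq, coeff_single_neg_mul_coe]
      simp only [hQ, coeff_single_neg_mul_coe, red_mk]
      split_ifs with h
      · simp
      · rw [PowerSeries.coeff_map, PowerSeries.coeff_map, red_apply]; rfl
    · rw [hden, hAmap]
      refine height_div_le _ _ (mul_ne_zero ?_ hc0) ?_ ((hdegC _).trans (hc 0))
      · rw [Ne, Polynomial.C_eq_zero]; exact inv_ne_zero hbX
      · rw [Polynomial.natDegree_neg]; exact (hdegC _).trans (hc i)
  · refine laurentCongr_of_red_eq_zero _ _ (PowerSeries.X ^ e * F -
      ∑ i ∈ Finset.Icc 1 N, (A i : (ZLoc p)⟦X⟧) * J * F ^ p ^ (i * l)) e ?_ ?_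
    · rw [map_sub, map_sub, mul_sub, map_mul (PowerSeries.map (ZLoc p).subtype) (_ ^ e),
        map_pow (PowerSeries.map (ZLoc p).subtype) PowerSeries.X, PowerSeries.map_X,
        single_neg_mul_coe_X_pow_mul, map_sum, map_sum, Finset.mul_sum]
      congr 1
      refine Finset.sum_congr rfl fun i _ => ?_
      rw [hQ, mul_assoc, map_mul (PowerSeries.map (ZLoc p).subtype) (_ * J),
        map_mul (HahnSeries.ofPowerSeries ℤ ℚ), map_pow,
        map_pow (HahnSeries.ofPowerSeries ℤ ℚ)]
    · have hBJ : (b' : (ZMod p)⟦X⟧) * PowerSeries.map (red p) J = 1 := by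
        rw [← hBmap, Polynomial.polynomial_map_coe, ← map_mul, hJ, map_one]
      have hr : Finset.range (N + 1) = insert 0 (Finset.Icc 1 N) := by
        ext i; simp only [Finset.mem_range, Finset.mem_insert, Finset.mem_Icc]; omega
      rw [hr, Finset.sum_insert (by simp)] at hrel
      rw [mul_zero, pow_zero, pow_one] at hrel
      have h0 := congrArg (fun g : (ZMod p)[X] => (g : (ZMod p)⟦X⟧)) hden
      simp only [hBmap, Polynomial.coe_mul, Polynomial.coe_pow, Polynomial.coe_X] at h0
      have hA' : ∀ i, PowerSeries.map (red p) (A i : (ZLoc p)⟦X⟧) =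
          -(((Polynomial.C κ⁻¹ : (ZMod p)[X]) : (ZMod p)⟦X⟧) * (c i : (ZMod p)⟦X⟧)) := by
        intro i
        rw [← Polynomial.polynomial_map_coe, hAmap, ← Polynomial.coe_mul,
          ← Polynomial.coeToPowerSeries.ringHom_apply, map_neg,
          Polynomial.coeToPowerSeries.ringHom_apply]
      simp only [map_sub, map_sum, map_mul, map_pow, PowerSeries.map_X, hA', mul_comm _ l]
      have hsum : ∑ i ∈ Finset.Icc 1 N,
          -(((Polynomial.C κ⁻¹ : (ZMod p)[X]) : (ZMod p)⟦X⟧) * (c i : (ZMod p)⟦X⟧)) *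
            PowerSeries.map (red p) J * PowerSeries.map (red p) F ^ p ^ (l * i) =
          -(((Polynomial.C κ⁻¹ : (ZMod p)[X]) : (ZMod p)⟦X⟧) * PowerSeries.map (red p) J) *
            ∑ i ∈ Finset.Icc 1 N,
              (c i : (ZMod p)⟦X⟧) * PowerSeries.map (red p) F ^ p ^ (l * i) := by
        rw [Finset.mul_sum]
        exact Finset.sum_congr rfl fun i _ => by ring
      rw [hsum]
      linear_combination (((Polynomial.C κ⁻¹ : (ZMod p)[X]) : (ZMod p)⟦X⟧) *
        PowerSeries.map (red p) J) * hrel + PowerSeries.map (red p) J *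
        PowerSeries.map (red p) F * h0 -
        PowerSeries.X ^ e * PowerSeries.map (red p) F * hBJ

/-- A relation `f = C f ^ q` over `𝔽_p` with `C` a polynomial lifts to a congruence. -/
theorem exists_lift_polynomial (F : (ZLoc p)⟦X⟧) {q : ℕ} (hq : 0 < q) (c : (ZMod p)[X])
    (hc : c.natDegree ≤ q - 1)
    (hrel : PowerSeries.map (red p) F =
      (c : (ZMod p)⟦X⟧) * PowerSeries.map (red p) F ^ q) :
    ∃ Q : (ZLoc p)[X], Q.degree < (q : WithBot ℕ) ∧
      LaurentCongr p ((PowerSeries.map (ZLoc p).subtype F : ℚ⟦X⟧) : ℚ⸨X⸩)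
        (((Q.map (ZLoc p).subtype : ℚ[X]) : ℚ⟦X⟧) *
          ((PowerSeries.map (ZLoc p).subtype F : ℚ⟦X⟧) : ℚ⸨X⸩) ^ q) := by
  obtain ⟨Q, hQ, hdeg⟩ := Polynomial.exists_natDegree_eq_of_mem_lifts
    (Polynomial.mem_lifts_of_surjective red_surjective c)
  refine ⟨Q, ?_, laurentCongr_of_red_eq_zero _ _ (F - (Q : (ZLoc p)⟦X⟧) * F ^ q) 0 ?_ ?_⟩
  · by_cases h0 : Q = 0
    · rw [h0, Polynomial.degree_zero]; exact WithBot.bot_lt_coe _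
    · rw [← Polynomial.natDegree_lt_iff_degree_lt h0]
      omega
  · rw [Polynomial.polynomial_map_coe, map_sub, map_sub, map_mul, map_pow, PowerSeries.coe_mul,
      PowerSeries.coe_pow, Nat.cast_zero, neg_zero, HahnSeries.single_zero_one, one_mul]
  · rw [map_sub, map_mul, map_pow, ← Polynomial.polynomial_map_coe, hQ, sub_eq_zero]
    exact hrel

end

/-! ### The order of `p` and bounds for heights -/

section

variable {p : ℕ} [hp : Fact p.Prime]

theorem denLcm_ne_zero {n : ℕ} (α β : Fin n → ℚ) : denLcm α β ≠ 0 := by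
  unfold denLcm
  refine Nat.lcm_ne_zero ?_ ?_ <;>
  · rw [Ne, Finset.lcm_eq_zero_iff]
    rintro ⟨i, -, hi⟩
    exact Rat.den_ne_zero _ hi

theorem coprime_denLcm {n : ℕ} {α β : Fin n → ℚ} (hα : ∀ i, α i ∈ ZLoc p)
    (hβ : ∀ i, β i ∈ ZLoc p) : Nat.Coprime p (denLcm α β) := by
  have hcop : ∀ γ : Fin n → ℚ, (∀ i, γ i ∈ ZLoc p) →
      Nat.Coprime p (Finset.univ.lcm fun i => (γ i).den) := fun γ hγ =>
    Nat.Coprime.coprime_dvd_right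
      (Finset.lcm_dvd fun i hi => Finset.dvd_prod_of_mem (fun i => (γ i).den) hi)
      (Nat.Coprime.prod_right fun i _ => (Nat.Prime.coprime_iff_not_dvd hp.out).2 (hγ i))
  exact Nat.Coprime.coprime_dvd_right (Nat.lcm_dvd_mul _ _)
    (Nat.Coprime.mul_right (hcop α hα) (hcop β hβ))

theorem pow_eq_one_of_dvd {p d e l : ℕ} (h : e ∣ d) (hd : (p : ZMod d) ^ l = 1) :
    (p : ZMod e) ^ l = 1 := by
  have := congrArg (ZMod.castHom h (ZMod e)) hd
  rwa [map_pow, map_natCast, map_one] at this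

theorem height_bound (t q : ℕ) (hq : 0 < q) :
    (t + 1) * (q - 1) < 5 ^ t * (t + 1).factorial * q ^ 2 := by
  have h1 : t + 1 ≤ 5 ^ t * (t + 1).factorial :=
    (Nat.self_le_factorial _).trans (Nat.le_mul_of_pos_left _ (by positivity))
  have h2 : q - 1 < q ^ 2 := lt_of_lt_of_le (by omega) (Nat.le_self_pow two_ne_zero q)
  exact Nat.mul_lt_mul_of_le_of_lt h1 h2 (by positivity)

end

end HypMod

end

theorem theorem3p2 {n : ℕ} (α β : Fin (n + 1) → ℚ)
    (hα : ∀ i, 0 < α i ∧ α i ≤ 1) (hβ : ∀ i, 0 < β i ∧ β i ≤ 1)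
    (hβ_last : β (Fin.last n) = 1)
    (p : ℕ) [Fact p.Prime]
    (hf : ∀ i, PowerSeries.coeff i (HypMod.hypSeries α β) ∈ HypMod.ZLoc p)
    (l : ℕ) (hl : l = orderOf (p : ZMod (HypMod.denLcm α β)))
    (hP : HypMod.PProp α β p l)
    (hα_unit : ∀ i, HypMod.IsUnitLoc p (α i)) (hβ_unit : ∀ i, HypMod.IsUnitLoc p (β i))
    (f : LaurentSeries ℚ) (hf_def : f = (HypMod.hypSeries α β : PowerSeries ℚ))
    (S : Finset ℕ)
    (hS : S = HypMod.sSet ((HypMod.dworkVec p)^[l - 1] α) ((HypMod.dworkVec p)^[l - 1] β) p) :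
    (S.card = 1 →
      ∃ Q₁ : Polynomial (HypMod.ZLoc p), Q₁.degree < ((p ^ l : ℕ) : WithBot ℕ) ∧
        HypMod.LaurentCongr p f
          (((Q₁.map (HypMod.ZLoc p).subtype : Polynomial ℚ) : PowerSeries ℚ) * f ^ p ^ l)) ∧
    (S.card = 2 →
      ∃ Q₁ Q₂ : RatFunc ℚ, HypMod.IsIntegralAt p Q₁ ∧ HypMod.IsIntegralAt p Q₂ ∧
        (∃ q₁ : RatFunc (ZMod p), HypMod.ReducesTo p Q₁ q₁ ∧
          HypMod.height q₁ < 2 * p ^ (2 * l)) ∧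
        (∃ q₂ : RatFunc (ZMod p), HypMod.ReducesTo p Q₂ q₂ ∧
          HypMod.height q₂ < 2 * p ^ (2 * l)) ∧
        HypMod.LaurentCongr p f
          ((Q₁ : LaurentSeries ℚ) * f ^ p ^ l + (Q₂ : LaurentSeries ℚ) * f ^ p ^ (2 * l))) ∧
    (∀ t : ℕ, 2 < t + 1 → S.card = t + 1 →
      ∃ Q : ℕ → RatFunc ℚ,
        (∀ i ∈ Finset.Icc 1 (t + 1), HypMod.IsIntegralAt p (Q i) ∧
          ∃ q : RatFunc (ZMod p), HypMod.ReducesTo p (Q i) q ∧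
            HypMod.height q < 5 ^ t * (t + 1).factorial * p ^ (2 * (t + 1) * l)) ∧
        HypMod.LaurentCongr p f
          (∑ i ∈ Finset.Icc 1 (t + 1), (Q i : LaurentSeries ℚ) * f ^ p ^ (i * l))) := by
  have hp : p.Prime := Fact.out
  have hint : ∀ i, HypMod.hypCoeff α β i ∈ HypMod.ZLoc p := fun i => by
    have := hf i
    rwa [HypMod.hypSeries, PowerSeries.coeff_mk] at this
  have hcop : Nat.Coprime p (HypMod.denLcm α β) :=
    HypMod.coprime_denLcm hP.mem_left hP.mem_right
  have hl1 : 1 ≤ l := by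
    have : NeZero (HypMod.denLcm α β) := ⟨HypMod.denLcm_ne_zero α β⟩
    rw [hl, ← ZMod.coe_unitOfCoprime p hcop, orderOf_units]
    exact orderOf_pos _
  have hpow : (p : ZMod (HypMod.denLcm α β)) ^ l = 1 := by rw [hl, pow_orderOf_eq_one]
  have hdα : ∀ i, (α i).den ∣ HypMod.denLcm α β := fun i =>
    (Finset.dvd_lcm (f := fun i => (α i).den) (Finset.mem_univ i)).trans (Nat.dvd_lcm_left _ _)
  have hdβ : ∀ i, (β i).den ∣ HypMod.denLcm α β := fun i =>
    (Finset.dvd_lcm (f := fun i => (β i).den) (Finset.mem_univ i)).trans (Nat.dvd_lcm_right _ _)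
  obtain ⟨y, C, hy0, h0S, hC, hy⟩ := HypMod.exists_frobenius_system hα hβ hβ_last hint hl1 hP
    (fun i => HypMod.iterate_dwork_eq_self (hα i) (hP.mem_left i)
      (HypMod.pow_eq_one_of_dvd (hdα i) hpow))
    (fun i => HypMod.iterate_dwork_eq_self (hβ i) (hP.mem_right i)
      (HypMod.pow_eq_one_of_dvd (hdβ i) hpow))
  rw [← hS] at h0S hy
  -- the series over `ℤ_(p)`, which maps to `f` over `ℚ` and to `y 0` over `𝔽_p`
  set F : PowerSeries (HypMod.ZLoc p) :=
    PowerSeries.mk fun i => ⟨HypMod.hypCoeff α β i, hint i⟩ with hF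
  have hFf : f = ((PowerSeries.map (HypMod.ZLoc p).subtype F : PowerSeries ℚ) :
      LaurentSeries ℚ) := by
    rw [hf_def]
    rfl
  have hFy : PowerSeries.map (HypMod.red p) F = y 0 := by
    rw [hy0]
    ext i
    rw [PowerSeries.coeff_map, hF, PowerSeries.coeff_mk, HypMod.red_mk, HypMod.redSeries,
      PowerSeries.coeff_mk]
  obtain ⟨c, hc, hc0, hrel⟩ := HypMod.exists_frobenius_relation hC hy h0S
  rw [← hFy] at hrel
  obtain ⟨Q, hQ, hcongr⟩ := HypMod.exists_lift_relation F c hc hc0 hrel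
  rw [← hFf] at hcongr
  refine ⟨fun hcard => ?_, fun hcard => ?_, fun t _ hcard => ?_⟩
  · obtain ⟨r, hr⟩ := Finset.card_eq_one.1 hcard
    have hr0 : r = 0 := by rw [hr, Finset.mem_singleton] at h0S; exact h0S.symm
    have h := hy 0 h0S
    rw [hr, hr0, Finset.sum_singleton, ← hFy] at h
    rw [hFf]
    exact HypMod.exists_lift_polynomial F (pow_pos hp.pos l) _ (hC 0 0) h
  · rw [hcard] at hQ hcongr
    have hb : 2 * (p ^ (l * 2) - 1) < 2 * p ^ (2 * l) := by
      rw [mul_comm l 2]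
      have := pow_pos hp.pos (2 * l)
      omega
    have hQ' := fun i => (hQ i).2.imp fun q hq => And.intro hq.1 (hq.2.trans_lt hb)
    refine ⟨Q 1, Q 2, (hQ 1).1, (hQ 2).1, hQ' 1, hQ' 2, ?_⟩
    rw [show Finset.Icc 1 2 = {1, 2} from rfl, Finset.sum_pair (by norm_num), one_mul] at hcongr
    exact hcongr
  · rw [hcard] at hQ hcongr
    have hb := HypMod.height_bound t _ (pow_pos hp.pos (l * (t + 1)))
    rw [← pow_mul, show l * (t + 1) * 2 = 2 * (t + 1) * l by ring] at hb
    exact ⟨Q, fun i _ => ⟨(hQ i).1, (hQ i).2.imp fun q hq => ⟨hq.1, hq.2.trans_lt hb⟩⟩, hcongr⟩
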